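/- **Setting.** Graphs $G=(V,E)$ are simple, countable, locally finite, with a root, with edge marks $\bar\kappa_e$ in a Polish space $\overline{\mathcal K}$ and vertex marks $\kappa_v$ in a Polish space $\mathcal K$. Write $\mathrm{cl}(v)=\{v\}\cup\{\text{neighbours of }v\}$, $G[W]$ for the induced marked subgraph on $W$, and $B_\ell(G)$ for the set of vertices within distance $\ell\in\mathbb N_0$ of the root (and the subgraph induced on it). Let $\mathcal X\subseteq\mathbb Z$, let $\mathcal J\subseteq\{i-j:i\ne j\in\mathcal X\}$ carry a finite measure $\varsigma$ that charges every point and has $\sum_j|j|\varsigma(j)<\infty$, and let $\mathcal D$ be the space of càdlàg paths $[0,\infty)\to\mathcal X$. The jump rates are $r^{G,v}_j(t,x)=\bar r_j^{H_v}\big(t,x_{\mathrm{cl}(v)},\bar\kappa|_{E(H_v)},\kappa|_{\mathrm{cl}(v)}\big)\in[0,\infty)$, where $H_v=G[\mathrm{cl}(v)]$ is rooted at $v$ and the functions $\bar r^H_j$ are Borel measurable, invariant under rooted isomorphism of $H$ (for $t>0$), and predictable (for $t>0$ the value at $(t,x)$ depends on $x$ only through $x|_{[0,t)}$). A filtration-Poisson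 process pair $(\mathbb F,\mathbf N^G)$ on a complete probability space consists of a filtration $\mathbb F$ satisfying the usual conditions and an $\mathbb F$-adapted family $\mathbf N^G=(\mathbf N^G_v)_{v\in V}$ of i.i.d. simple Poisson point processes on $\mathbb R_+^2\times\mathcal J$ with intensity $\mathrm{Leb}^2\otimes\varsigma$ such that $\mathbf N^G$ is independent of $\mathcal F_0$ and, for all $t>0$ and Borel $A\subseteq(t,\infty)\times\mathbb R_+\times\mathcal J$, $(\mathbf N^G_v(A))_{v}$ is independent of $\mathcal F_t$. For $W\subseteq V$ let $\mathbf N^G_W=(\mathbf N^G_v)_{v\in W}$. The SDE for deterministic initial data $(G,\xi)$, $\xi\in\mathcal X^V$, is $$X_v(t)=\xi_v+\int_{(0,t]\times\mathbb R_+\times\mathcal J} j\,\mathbf 1\{r\le r^{G,v}_j(s,X)\}\,\mathbf N^G_v(ds,dr,dj),\qquad v\in V,\ t\ge0;$$ an $(\mathbb F,\mathbf N^G)$-weak solution is an $\mathbb F$-adapted $\mathcal D^V$-valued process satisfying it a.s.; it is an $\mathbf N^G$-strong solution if it is adapted to $\mathbb F^{\mathbf N^G}$, the augmented (complete, right-continuous)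 filtration generated by $\mathbf N^G$. **Bounded rates.** Assume that there are constants $C_{k,T}\in(0,\infty)$, non-decreasing in $k$ and $T$, with $r^{G,v}_j(t,x)\le C_{|\mathrm{cl}(v)|,T}$ for all $G,v,j,x$ and $0\le t\le T$. Put $\mathbf N^{G,T}_v(A)=\mathbf N^G_v(A\times(0,C_{|\mathrm{cl}(v)|,T}]\times\mathcal J)$ for Borel $A\subseteq(0,T]$. The graph $G$ is *finitely dissociable* if for every $T\in(0,\infty)$ there is $\Delta\in(0,T]$ such that a.s. the subgraph of $G$ induced by $\{v:\mathbf N^{G,T}_v(0,\Delta]>0\}$ has only finite connected components (this depends only on the law of $\mathbf N^G$). **Causal chains.** For $T\ge0$ and finite $U\subseteq V$, $\mathcal A_T(U)=\mathcal A_T(U;G,\mathbf N^G)$ is the set of vertices $v$ for which there are $u\in U$, $n\ge0$, a path $v=u_0,u_1,\dots,u_n=u$ in $G$ and, if $n\ge1$, times $0<s_1<\dots<s_n\le T$ with $\mathbf N^{G,T}_{u_i}(\{s_i\})=1$ for $1\le i\le n$. **Localizing maps.** Given $(\mathbb F,\mathbf N^G)$ on $(\Omega,\mathcal F,\mathbb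 P)$ and $T\ge0$, a *localizing map* for the SDE on $(G,\mathbf N^G)$ is a map $\mathcal S_T$ that assigns to each finite $U\subseteq V$ and $\omega\in\Omega$ a set $\mathcal S_T(U)(\omega)\subseteq V$ with $U\subseteq\mathcal S_T(U)$, such that $\{\mathcal S_T(U)\subseteq U'\}\in\mathcal F_T^{\mathbf N^G}$ for all finite $U,U'$, such that $\mathcal S_T(U)$ is a.s. finite, and such that the following holds. For all $\ell$, all $\xi\in\mathcal X^V$, all $U\subseteq B_\ell(G)\subseteq W\subseteq V$, every $(\mathbb F,\mathbf N^G_W)$-weak solution $X$ for $(G[W],\xi_W)$ and the $\mathbf N^G_{B_\ell(G)}$-strong solution $Y$ for $(B_\ell(G),\xi_{B_\ell(G)})$ (any such solution), $$X_v(t)=Y_v(t)\quad\text{for all }v\in U,\ t\le T,\quad\text{a.s. on }\{\mathcal S_T(U)\subseteq B_\ell(G)\}.$$ $G$ *spatially localizes* the SDE if a localizing map exists for every pair $(\mathbb F,\mathbf N^G)$ and every $T\ge 0$. **Consistency.** A sequence $(G_n)_{n}$ *consistently spatially localizes* the SDE if for every $T\ge0$ and all pairs $(\mathbb F^n,\mathbf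 N^{G_n})$ on a common complete probability space there is a *consistent sequence of localizing maps*: a localizing map $\mathcal S^n_T$ for $(G_n,\mathbf N^{G_n})$ for each $n$, such that for all $n,n',\ell$, all isomorphisms $\varphi:B_\ell(G_{n'})\to B_\ell(G_n)$ of rooted unmarked graphs with $\deg_{G_{n}}(\varphi(v))=\deg_{G_{n'}}(v)$ for every $v\in B_\ell(G_{n'})$ (degrees in the whole graphs; a condition only on vertices at distance exactly $\ell$ from the root, automatic if $\varphi$ extends to an isomorphism of the balls of radius $\ell+1$), and all $U\subseteq B_\ell(G_n)$ with $U'=\varphi^{-1}(U)$, $$\mathcal S^n_T(U)=\varphi\big(\mathcal S^{n'}_T(U')\big)\quad\text{(in particular }\mathcal S^{n'}_T(U')\subseteq B_\ell(G_{n'})\text{)}$$ a.s. on the event that $\mathcal S^n_T(U)\subseteq B_\ell(G_n)$ and that $\mathbf N^{G_{n'}}_v=\mathbf N^{G_n}_{\varphi(v)}$ on $[0,T]\times\mathbb R_+\times\mathcal J$ for all $v\in B_\ell(G_{n'})$. **Proposition.** Under the bounded-rate assumption: 1. Every deterministic finitely dissociable graph $G$ spatially localizes the SDE; for every pair $(\mathbb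 F,\mathbf N^G)$ and every $T\ge0$, $U\mapsto\mathcal A_T(U;G,\mathbf N^G)$ is a localizing map. 2. Every sequence $(G_n)$ of deterministic finitely dissociable graphs consistently spatially localizes the SDE; for all pairs on a common complete probability space and every $T\ge0$, the maps $U\mapsto\mathcal A_T(U;G_n,\mathbf N^{G_n})$ form a consistent sequence of localizing maps. -/

import Mathlib

open MeasureTheory ProbabilityTheory Set Filter Topology
open scoped NNReal ENNReal

universe u w

noncomputable section

namespace IPS

/-! ### Path space, point processes, driving noise -/

/-- The space `𝒟` of càdlàg functions `[0,∞) → 𝒳`, where `𝒳 ⊆ ℤ` carries the discrete topology. -/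
def Path (𝒳 : Set ℤ) : Type :=
  {x : ℝ≥0 → 𝒳 // (∀ t, ContinuousWithinAt x (Ici t) t) ∧
    ∀ t, 0 < t → ∃ l, Tendsto x (𝓝[<] t) (𝓝 l)}

/-- The σ-algebra generated by the evaluations; on càdlàg paths it is the Borel σ-algebra of
the Skorokhod `J1` topology. -/
instance (𝒳 : Set ℤ) : MeasurableSpace (Path 𝒳) :=
  MeasurableSpace.comap (fun x : Path 𝒳 => x.1) MeasurableSpace.pi

instance (𝒳 : Set ℤ) : CoeFun (Path 𝒳) (fun _ => ℝ≥0 → 𝒳) := ⟨Subtype.val⟩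

/-- The space `[0,∞) × [0,∞) × 𝒥` of (time, level, jump) triples. -/
abbrev Points (𝒥 : Set ℤ) : Type := ℝ≥0 × ℝ≥0 × 𝒥

/-- Simple locally finite integer-valued measures: counting measures of sets that meet every
compact set in finitely many points. -/
def IsSimplePointMeasure {E : Type*} [TopologicalSpace E] [MeasurableSpace E]
    (μ : Measure E) : Prop :=
  ∃ S : Set E, (∀ K, IsCompact K → (S ∩ K).Finite) ∧ μ = Measure.count.restrict S

/-- `N` is a (simple) Poisson point process with intensity measure `ζ`. -/
structure IsPoissonProcess {Ω : Type*} [MeasurableSpace Ω] (P : Measure Ω)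
    {E : Type*} [TopologicalSpace E] [MeasurableSpace E]
    (ζ : Measure E) (N : Ω → Measure E) : Prop where
  simple : ∀ ω, IsSimplePointMeasure (N ω)
  measurable : Measurable N
  law : ∀ A, MeasurableSet A → ζ A ≠ ∞ →
    P.map (fun ω => N ω A) = (poissonMeasure (ζ A).toNNReal).map (fun n : ℕ => (n : ℝ≥0∞))
  indep : ∀ (k : ℕ) (A : Fin k → Set E), (∀ i, MeasurableSet (A i)) →
    Pairwise (fun i j => Disjoint (A i) (A j)) → iIndepFun (fun i ω => N ω (A i)) P

/-- Lebesgue measure on `[0,∞)`. -/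
def leb : Measure ℝ≥0 := Measure.comap ((↑) : ℝ≥0 → ℝ) volume

/-- The intensity measure `Leb² ⊗ ς`. -/
def intensity {𝒥 : Set ℤ} (ς : Measure 𝒥) : Measure (Points 𝒥) := leb.prod (leb.prod ς)

/-- A family of i.i.d. Poisson processes with intensity `Leb² ⊗ ς`, indexed by the vertices. -/
structure IsPoissonNoise {Ω : Type*} [MeasurableSpace Ω] (P : Measure Ω) {𝒥 : Set ℤ}
    (ς : Measure 𝒥) {V : Type*} (N : V → Ω → Measure (Points 𝒥)) : Prop where
  poisson : ∀ v, IsPoissonProcess P (intensity ς) (N v)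
  indep : iIndepFun N P

/-- `(𝔽, N)` is a filtration-Poisson process pair on the complete filtered probability space
`(Ω, 𝓕, 𝔽, P)`, for a deterministic graph with vertex set `V`. -/
structure IsNoisePair {Ω : Type*} [mΩ : MeasurableSpace Ω] (P : Measure Ω)
    (𝔽 : Filtration ℝ≥0 mΩ) {𝒥 : Set ℤ} (ς : Measure 𝒥)
    {V : Type*} (N : V → Ω → Measure (Points 𝒥)) : Prop where
  prob : IsProbabilityMeasure P
  complete : P.IsComplete
  null_mem : ∀ A, P A = 0 → MeasurableSet[𝔽 0] A
  rightCont : ∀ t, (⨅ s > t, (𝔽 s : MeasurableSpace Ω)) = 𝔽 t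
  noise : IsPoissonNoise P ς N
  indep_zero : Indep (⨆ v, MeasurableSpace.comap (N v) inferInstance) (𝔽 0) P
  indep_future : ∀ t, 0 < t → ∀ A : Set (Points 𝒥), MeasurableSet A → A ⊆ Ioi t ×ˢ univ →
    Indep (⨆ v, MeasurableSpace.comap (fun ω => N v ω A) inferInstance) (𝔽 t) P
  adapted : ∀ v t, ∀ A : Set (Points 𝒥), MeasurableSet A → A ⊆ Iic t ×ˢ univ →
    Measurable[𝔽 t] (fun ω => N v ω A)

/-- `𝔽^N`, the augmentation (completion and right-continuous regularization) of the filtration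
`σ(N_v(A) : v ∈ V, A ∈ 𝓑([0,t] × [0,∞) × 𝒥))`. -/
def noiseFiltration {Ω : Type*} [MeasurableSpace Ω] (P : Measure Ω) {𝒥 : Set ℤ}
    {V : Type*} (N : V → Ω → Measure (Points 𝒥)) (t : ℝ≥0) : MeasurableSpace Ω :=
  ⨅ s > t, ((⨆ (v : V) (A : Set (Points 𝒥)) (_ : MeasurableSet A ∧ A ⊆ Iic s ×ˢ univ),
      MeasurableSpace.comap (fun ω => N v ω A) inferInstance) ⊔
    MeasurableSpace.generateFrom {A | P A = 0})

/-! ### Marked graphs and the interacting particle system -/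

/-- A graph on `V` (simple, countable, locally finite) with edge marks in `Ke` and
vertex marks in `Kv`. -/
structure MarkedGraph (V : Type u) (Ke Kv : Type*) where
  graph : SimpleGraph V
  countable : Countable V
  locallyFinite : ∀ v, (graph.neighborSet v).Finite
  edgeMark : graph.edgeSet → Ke
  vertexMark : V → Kv

/-- The closure `cl(v)`: `v` together with its neighbors. -/
def closedNbhd {V : Type u} (G : SimpleGraph V) (v : V) : Set V := insert v (G.neighborSet v)

/-- The set of vertices within graph distance `ℓ` of the root `o`. -/
def ball {V : Type u} (G : SimpleGraph V) (o : V) (ℓ : ℕ) : Set V := {v | G.edist o v ≤ ℓ}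

/-- The induced marked subgraph `G[W]`. -/
def MarkedGraph.induce {V : Type u} {Ke Kv : Type*} (G : MarkedGraph V Ke Kv) (W : Set V) :
    MarkedGraph W Ke Kv where
  graph := G.graph.induce W
  countable := by have := G.countable; infer_instance
  locallyFinite := fun v => (G.locallyFinite v).preimage Subtype.val_injective.injOn
  edgeMark := fun e => G.edgeMark ((SimpleGraph.Embedding.induce W).mapEdgeSet e)
  vertexMark := fun v => G.vertexMark v

/-- Finite rooted graphs in which every vertex other than the root is a neighbor of the root. -/
structure RootedStar : Type (u + 1) where
  V : Type u
  finite : Finite V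
  graph : SimpleGraph V
  root : V
  adj_root : ∀ v, v ≠ root → graph.Adj root v

/-- The rooted graph `(G[cl(v)], v)`. -/
def localStar {V : Type u} {Ke Kv : Type*} (G : MarkedGraph V Ke Kv) (v : V) :
    RootedStar.{u} where
  V := closedNbhd G.graph v
  finite := ((G.locallyFinite v).insert v).to_subtype
  graph := G.graph.induce (closedNbhd G.graph v)
  root := ⟨v, mem_insert _ _⟩
  adj_root := by
    rintro ⟨x, hx⟩ hne
    rcases hx with hx | hx
    · exact absurd (Subtype.ext hx) hne
    · exact hx

/-- The data of the particle system: the finite measure `ς` on the set `𝒥` of allowed jumps and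
the regular local jump rate functions `rate j H`, for finite rooted graphs `H` of radius one. -/
structure Model (𝒳 𝒥 : Set ℤ) (Ke Kv : Type*) [MeasurableSpace Ke] [MeasurableSpace Kv] where
  jump_mem : ∀ j ∈ 𝒥, ∃ a ∈ 𝒳, ∃ b ∈ 𝒳, a ≠ b ∧ j = a - b
  ς : Measure 𝒥
  ς_finite : IsFiniteMeasure ς
  ς_pos : ∀ j, 0 < ς {j}
  ς_moment : Integrable (fun j : 𝒥 => ((j : ℤ) : ℝ)) ς
  rate : 𝒥 → (H : RootedStar.{u}) →
    ℝ≥0 → (H.V → Path 𝒳) → (H.graph.edgeSet → Ke) → (H.V → Kv) → ℝ≥0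
  rate_measurable : ∀ j H, Measurable
    (fun p : ℝ≥0 × (H.V → Path 𝒳) × (H.graph.edgeSet → Ke) × (H.V → Kv) =>
      rate j H p.1 p.2.1 p.2.2.1 p.2.2.2)
  rate_class : ∀ j (H H' : RootedStar.{u}) (φ : H'.graph ≃g H.graph), φ H'.root = H.root →
    ∀ t, 0 < t → ∀ x e k,
      rate j H t x e k = rate j H' t (fun v => x (φ v)) (fun a => e (φ.mapEdgeSet a))
        (fun v => k (φ v))
  rate_predictable : ∀ j H e k t, 0 < t → ∀ x y : H.V → Path 𝒳,
    (∀ v, ∀ s < t, x v s = y v s) → rate j H t x e k = rate j H t y e k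

section

variable {𝒳 𝒥 : Set ℤ} {Ke Kv : Type*} [MeasurableSpace Ke] [MeasurableSpace Kv]

/-- The jump rate function `r_j^{G,v}(t, x)`. -/
def Model.jumpRate (M : Model.{u} 𝒳 𝒥 Ke Kv) {V : Type u} (G : MarkedGraph V Ke Kv) (v : V)
    (j : 𝒥) (t : ℝ≥0) (x : V → Path 𝒳) : ℝ≥0 :=
  M.rate j (localStar G v) t (fun a : closedNbhd G.graph v => x a)
    (G.induce (closedNbhd G.graph v)).edgeMark (G.induce (closedNbhd G.graph v)).vertexMark

/-- The bounded-rate assumption, with the non-decreasing family of constants `C k T > 0`. -/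
structure BoundedRates (M : Model.{u} 𝒳 𝒥 Ke Kv) (C : ℕ → ℝ≥0 → ℝ≥0) : Prop where
  pos : ∀ k T, 0 < C k T
  mono : ∀ k k' T T', k ≤ k' → T ≤ T' → C k T ≤ C k' T'
  bound : ∀ (V : Type u) (G : MarkedGraph V Ke Kv) (v : V) (j : 𝒥) (x : V → Path 𝒳)
    (T t : ℝ≥0), t ≤ T → M.jumpRate G v j t x ≤ C (closedNbhd G.graph v).ncard T

/-- `X` is an `(𝔽, N)`-weak solution of the SDE
`X_v(t) = ξ_v + ∫_{(0,t] × [0,∞) × 𝒥} j 1{r ≤ r_j^{G,v}(s, X)} N_v(ds, dr, dj)`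
for the initial data `(G, ξ)`. -/
structure IsSolution (M : Model.{u} 𝒳 𝒥 Ke Kv) {V : Type u} (G : MarkedGraph V Ke Kv)
    (ξ : V → 𝒳) {Ω : Type w} [MeasurableSpace Ω] (P : Measure Ω)
    (𝔽 : ℝ≥0 → MeasurableSpace Ω) (N : V → Ω → Measure (Points 𝒥))
    (X : V → Ω → Path 𝒳) : Prop where
  adapted : ∀ v t, Measurable[𝔽 t] (fun ω => X v ω t)
  sde : ∀ᵐ ω ∂P, ∀ v t,
    IntegrableOn
      (fun z : Points 𝒥 => if z.2.1 ≤ M.jumpRate G v z.2.2 z.1 (fun u => X u ω)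
        then ((z.2.2 : ℤ) : ℝ) else 0) (Ioc 0 t ×ˢ univ) (N v ω) ∧
    (((X v ω t : 𝒳) : ℤ) : ℝ) = ((ξ v : ℤ) : ℝ) +
      ∫ z in Ioc 0 t ×ˢ univ, (if z.2.1 ≤ M.jumpRate G v z.2.2 z.1 (fun u => X u ω)
        then ((z.2.2 : ℤ) : ℝ) else 0) ∂(N v ω)

/-- `X` is an `N`-strong solution: a solution adapted to the augmented filtration of `N`. -/
def IsStrongSolution (M : Model.{u} 𝒳 𝒥 Ke Kv) {V : Type u} (G : MarkedGraph V Ke Kv)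
    (ξ : V → 𝒳) {Ω : Type w} [MeasurableSpace Ω] (P : Measure Ω)
    (N : V → Ω → Measure (Points 𝒥)) (X : V → Ω → Path 𝒳) : Prop :=
  IsSolution M G ξ P (noiseFiltration P N) N X

/-! ### Spatial localization -/

/-- `S` is a localizing map, up to time `T`, for the SDE on `(G, N)`, where `G` has root `o`. -/
structure IsLocalizingMap (M : Model.{u} 𝒳 𝒥 Ke Kv) {V : Type u} (G : MarkedGraph V Ke Kv)
    (o : V) {Ω : Type w} [mΩ : MeasurableSpace Ω] (P : Measure Ω) (𝔽 : Filtration ℝ≥0 mΩ)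
    (N : V → Ω → Measure (Points 𝒥)) (T : ℝ≥0) (S : Finset V → Ω → Set V) : Prop where
  measurable : ∀ U U' : Finset V,
    MeasurableSet[noiseFiltration P N T] {ω | S U ω ⊆ (U' : Set V)}
  finite : ∀ U : Finset V, ∀ᵐ ω ∂P, (S U ω).Finite
  subset : ∀ (U : Finset V) ω, (U : Set V) ⊆ S U ω
  localizes : ∀ (ℓ : ℕ) (ξ : V → 𝒳) (U : Finset V) (W : Set V)
    (hU : (U : Set V) ⊆ ball G.graph o ℓ) (hW : ball G.graph o ℓ ⊆ W)
    (X : W → Ω → Path 𝒳),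
    IsSolution M (G.induce W) (fun v => ξ v) P 𝔽 (fun v => N v) X →
    ∀ Y : ball G.graph o ℓ → Ω → Path 𝒳,
    IsStrongSolution M (G.induce (ball G.graph o ℓ)) (fun v => ξ v) P (fun v => N v) Y →
    ∀ᵐ ω ∂P, S U ω ⊆ ball G.graph o ℓ →
      ∀ (v : V) (hv : v ∈ U) (t : ℝ≥0), t ≤ T →
        X ⟨v, hW (hU hv)⟩ ω t = Y ⟨v, hU hv⟩ ω t

/-- The graph `G` with root `o` spatially localizes the SDE. -/
def SpatiallyLocalizes (M : Model.{u} 𝒳 𝒥 Ke Kv) {V : Type u} (G : MarkedGraph V Ke Kv)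
    (o : V) : Prop :=
  ∀ (Ω : Type w) (mΩ : MeasurableSpace Ω) (P : Measure Ω) (𝔽 : Filtration ℝ≥0 mΩ)
    (N : V → Ω → Measure (Points 𝒥)), IsNoisePair P 𝔽 M.ς N →
    ∀ T : ℝ≥0, ∃ S : Finset V → Ω → Set V, IsLocalizingMap M G o P 𝔽 N T S

/-- `(S n)` is a consistent sequence of localizing maps for the SDE on `(G n, N n)`, `n ∈ ℕ`.
In `consistent`, `φ` is an isomorphism of the rooted balls of radius `ℓ` that preserves the
degrees in the ambient graphs, `U' = φ⁻¹(U)`, and the conclusion says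
`S n U = φ (S n' U')`. -/
structure IsConsistentSequence (M : Model.{u} 𝒳 𝒥 Ke Kv) {V : ℕ → Type u}
    (G : (n : ℕ) → MarkedGraph (V n) Ke Kv) (o : (n : ℕ) → V n)
    {Ω : Type w} [mΩ : MeasurableSpace Ω] (P : Measure Ω) (𝔽 : ℕ → Filtration ℝ≥0 mΩ)
    (N : (n : ℕ) → V n → Ω → Measure (Points 𝒥)) (T : ℝ≥0)
    (S : (n : ℕ) → Finset (V n) → Ω → Set (V n)) : Prop where
  localizing : ∀ n, IsLocalizingMap M (G n) (o n) P (𝔽 n) (N n) T (S n)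
  consistent : ∀ (n n' ℓ : ℕ)
    (φ : (G n').graph.induce (ball (G n').graph (o n') ℓ) ≃g
      (G n).graph.induce (ball (G n).graph (o n) ℓ)),
    (∀ x : ball (G n').graph (o n') ℓ, (x : V n') = o n' → (φ x : V n) = o n) →
    (∀ x : ball (G n').graph (o n') ℓ, (closedNbhd (G n').graph (x : V n')).ncard =
      (closedNbhd (G n).graph (φ x : V n)).ncard) →
    ∀ (U : Finset (V n)) (U' : Finset (V n')),
      (U : Set (V n)) ⊆ ball (G n).graph (o n) ℓ →
      (U' : Set (V n')) ⊆ ball (G n').graph (o n') ℓ →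
      (∀ x : ball (G n').graph (o n') ℓ, (x : V n') ∈ U' ↔ (φ x : V n) ∈ U) →
      ∀ᵐ ω ∂P, S n U ω ⊆ ball (G n).graph (o n) ℓ →
        (∀ x : ball (G n').graph (o n') ℓ, (N n' x ω).restrict (Iic T ×ˢ univ) =
          (N n (φ x) ω).restrict (Iic T ×ˢ univ)) →
        S n' U' ω ⊆ ball (G n').graph (o n') ℓ ∧
          S n U ω = (fun x : ball (G n').graph (o n') ℓ => (φ x : V n)) '' {x | (x : V n') ∈ S n' U' ω}

/-- The sequence of rooted graphs `(G n, o n)` consistently spatially localizes the SDE. -/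
def ConsistentlySpatiallyLocalizes (M : Model.{u} 𝒳 𝒥 Ke Kv) {V : ℕ → Type u}
    (G : (n : ℕ) → MarkedGraph (V n) Ke Kv) (o : (n : ℕ) → V n) : Prop :=
  ∀ (Ω : Type w) (mΩ : MeasurableSpace Ω) (P : Measure Ω) (𝔽 : ℕ → Filtration ℝ≥0 mΩ)
    (N : (n : ℕ) → V n → Ω → Measure (Points 𝒥)),
    (∀ n, IsNoisePair P (𝔽 n) M.ς (N n)) →
    ∀ T : ℝ≥0, ∃ S : (n : ℕ) → Finset (V n) → Ω → Set (V n),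
      IsConsistentSequence M G o P 𝔽 N T S

end

/-! ### Finite dissociability and causal chains -/

/-- The mass that `N^{G,T}_v` gives to a set `A` of times: the number of points of `N_v`
with time in `A` and level in `(0, C_{|cl(v)|,T}]`. -/
def thinned {𝒥 : Set ℤ} {V : Type u} (G : SimpleGraph V) (C : ℕ → ℝ≥0 → ℝ≥0) {Ω : Type w}
    (N : V → Ω → Measure (Points 𝒥)) (T : ℝ≥0) (v : V) (ω : Ω) (A : Set ℝ≥0) : ℝ≥0∞ :=
  N v ω (A ×ˢ Ioc 0 (C (closedNbhd G v).ncard T) ×ˢ univ)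

/-- `(G, N^{G,T})` `Δ`-dissociates at `ω`: the subgraph induced by the vertices with an event in
`(0, Δ]` has only finite connected components. -/
def Dissociates {𝒥 : Set ℤ} {V : Type u} (G : SimpleGraph V) (C : ℕ → ℝ≥0 → ℝ≥0) {Ω : Type w}
    (N : V → Ω → Measure (Points 𝒥)) (T Δ : ℝ≥0) (ω : Ω) : Prop :=
  ∀ c : (G.induce {v | 0 < thinned G C N T v ω (Ioc 0 Δ)}).ConnectedComponent, c.supp.Finite

/-- Finite dissociability. It depends only on the law of the i.i.d. Poisson noise, and `N`
ranges over all realizations of that noise. -/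
def FinitelyDissociable {𝒥 : Set ℤ} (ς : Measure 𝒥) (C : ℕ → ℝ≥0 → ℝ≥0) {V : Type u}
    (G : SimpleGraph V) : Prop :=
  ∀ T : ℝ≥0, 0 < T → ∃ Δ : ℝ≥0, 0 < Δ ∧ Δ ≤ T ∧
    ∀ (Ω : Type w) (_ : MeasurableSpace Ω) (P : Measure Ω) (_ : IsProbabilityMeasure P)
      (N : V → Ω → Measure (Points 𝒥)), IsPoissonNoise P ς N →
      ∀ᵐ ω ∂P, Dissociates G C N T Δ ω

/-- The set of event times of `N^{G,T}_v` in `(0, T]`. -/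
def eventTimes {𝒥 : Set ℤ} {V : Type u} (G : SimpleGraph V) (C : ℕ → ℝ≥0 → ℝ≥0) {Ω : Type w}
    (N : V → Ω → Measure (Points 𝒥)) (T : ℝ≥0) (ω : Ω) (v : V) : Set ℝ≥0 :=
  {t | t ∈ Ioc 0 T ∧ thinned G C N T v ω {t} = 1}

/-- There is a causal chain from `v` to `u` during `[t₁, t₂]`, for the sets `E w` of event times
of the vertices: a path `p 0 = v, p 1, …, p n = u` and, if `n ≠ 0`, times
`t₁ = s 0 < s 1 < ⋯ < s n ≤ t₂` with `s i ∈ E (p i)` for `1 ≤ i ≤ n`. -/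
def CausalChain {V : Type u} (G : SimpleGraph V) (E : V → Set ℝ≥0) (t₁ t₂ : ℝ≥0)
    (v u : V) : Prop :=
  ∃ (n : ℕ) (p : ℕ → V), p 0 = v ∧ p n = u ∧ (∀ i < n, G.Adj (p i) (p (i + 1))) ∧
    (∀ i k, i < k → k ≤ n → p i = p k → i = 0 ∧ k = n) ∧
    (n ≠ 0 → ∃ s : ℕ → ℝ≥0, s 0 = t₁ ∧ (∀ i < n, s i < s (i + 1)) ∧ s n ≤ t₂ ∧
      ∀ i, 1 ≤ i → i ≤ n → s i ∈ E (p i))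

/-- The random set `𝒜_T(U)` of vertices joined to `U` by a causal chain during `[0, T]`. -/
def causalSet {𝒥 : Set ℤ} {V : Type u} (G : SimpleGraph V) (C : ℕ → ℝ≥0 → ℝ≥0) {Ω : Type w}
    (N : V → Ω → Measure (Points 𝒥)) (T : ℝ≥0) (U : Finset V) (ω : Ω) : Set V :=
  {v | ∃ u ∈ U, CausalChain G (eventTimes G C N T ω) 0 T v u}

end IPS

end

namespace IPS

/-! ### Causal chains as an inductive predicate -/

/-! Bounded rates mean that a point of the noise at `u` can move the particle only if its level lies
below the constant attached to `u` and `T`; the times of such points are the event times of `u`.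
Between events nothing happens, and at an event only the state of `cl(u)` strictly before it
matters. Information therefore travels along causal chains, and everything reduces to the
combinatorics of chains with increasing event times (`Influences`), together with almost sure
regularity of the Poisson points.

Finiteness: cut time into windows of length `Δ`. Inside one window a chain moves among vertices that
are active there, hence in one finite component, which it enters from a neighbor; local finiteness
and induction over the windows conclude (`influenceSet_finite`). Each window sees a time-shifted
noise with the same law, so a single `Δ` serves all windows
(`FinitelyDissociable.ae_finite_causalSet`).

Localization: if two solutions disagree at `u`, some event at `u` was preceded by a disagreement in
`cl(u)`. Tracing back uses up event times of a finite set of vertices, so the descent terminates in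
a contradiction (`not_disagree_of_influenceSet_subset`, `IsSolution.ae_eq_of_causalSet_subset`).

Measurability: separating consecutive event times of a chain by points of a countable dense set
turns the existence of a chain into a countable union (`exists_mem_chainEvent_iff`).

Consistency: as soon as a vertex has an event, its whole neighborhood influences it. If the causal
set lies in the ball, equality of degrees then leaves no room for a chain in the other graph to
escape (`Influences.mem_of_subset`). -/

/-- `Influences G E v u t`: a chain of adjacent vertices leads from `v` to `u`, along event times
that increase strictly and end at `t`; for the trivial chain `t = 0`. -/
inductive Influences {V : Type u} (G : SimpleGraph V) (E : V → Set ℝ≥0) (v : V) :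
    V → ℝ≥0 → Prop
  | refl : Influences G E v v 0
  | step {w u : V} {s t : ℝ≥0} : Influences G E v w s → G.Adj w u → t ∈ E u → s < t →
      Influences G E v u t

/-- A chain of adjacent vertices with increasing event times can be taken to be a path. -/
theorem Influences.exists_path {V : Type u} {G : SimpleGraph V} {E : V → Set ℝ≥0} {v u : V}
    {t : ℝ≥0} (h : Influences G E v u t) :
    ∃ (n : ℕ) (p : ℕ → V) (s : ℕ → ℝ≥0), p 0 = v ∧ p n = u ∧ (∀ i < n, G.Adj (p i) (p (i + 1))) ∧
      (∀ i k, i < k → k ≤ n → p i ≠ p k) ∧ s 0 = 0 ∧ (∀ i < n, s i < s (i + 1)) ∧ s n ≤ t ∧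
      ∀ i, 1 ≤ i → i ≤ n → s i ∈ E (p i) := by
  induction h with
  | refl =>
    exact ⟨0, fun _ => v, fun _ => 0, rfl, rfl, by simp, by omega, rfl, by simp, le_rfl, by omega⟩
  | @step w u r t _ hadj htE hlt ih =>
    obtain ⟨n, p, s, hp0, hpn, hpadj, hinj, hs0, hs, hsn, hsE⟩ := ih
    -- If the chain has visited `u` before, it is cut at that visit. The last time then only
    -- decreases, which is why the claim asks for `s n ≤ t` and not for equality.
    by_cases hu : ∃ i ≤ n, p i = u
    · obtain ⟨i, hi, hpi⟩ := hu
      have hmono : ∀ k, i ≤ k → k ≤ n → s i ≤ s k := by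
        intro k hik
        induction k, hik using Nat.le_induction with
        | base => exact fun _ => le_rfl
        | succ k _ ihk => exact fun hk => (ihk (by omega)).trans (hs k (by omega)).le
      exact ⟨i, p, s, hp0, hpi, fun k hk => hpadj k (by omega),
        fun a b hab hb => hinj a b hab (by omega), hs0, fun k hk => hs k (by omega),
        (hmono n hi le_rfl).trans (hsn.trans hlt.le), fun k h1 hk => hsE k h1 (by omega)⟩
    · push Not at hu
      have hp : ∀ i ≤ n, Function.update p (n + 1) u i = p i := fun i hi =>
        Function.update_of_ne (by omega) _ _
      have hs' : ∀ i ≤ n, Function.update s (n + 1) t i = s i := fun i hi =>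
        Function.update_of_ne (by omega) _ _
      refine ⟨n + 1, Function.update p (n + 1) u, Function.update s (n + 1) t, ?_, ?_, ?_, ?_, ?_,
        ?_, ?_, ?_⟩
      · rw [hp 0 (by omega), hp0]
      · simp
      · intro i hi
        rcases Nat.lt_succ_iff_lt_or_eq.mp hi with h | rfl
        · rw [hp i h.le, hp (i + 1) h]; exact hpadj i h
        · rw [hp i le_rfl, Function.update_self, hpn]; exact hadj
      · intro i k hik hk
        rcases Nat.le_succ_iff.mp hk with h | rfl
        · rw [hp i (by omega), hp k h]; exact hinj i k hik h
        · rw [hp i (by omega), Function.update_self]; exact hu i (by omega)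
      · rw [hs' 0 (by omega), hs0]
      · intro i hi
        rcases Nat.lt_succ_iff_lt_or_eq.mp hi with h | rfl
        · rw [hs' i h.le, hs' (i + 1) h]; exact hs i h
        · rw [hs' i le_rfl, Function.update_self]; exact hsn.trans_lt hlt
      · simp
      · intro i h1 hi
        rcases Nat.le_succ_iff.mp hi with h | rfl
        · rw [hp i h, hs' i h]; exact hsE i h1 h
        · simpa using htE

/-- Closed paths, which `CausalChain` tolerates, make no difference: in one direction injectivity is
discarded, in the other the chain is shortened to a genuine path. The trivial chain carries time
`0`, matching `s 0 = 0`. -/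
theorem causalChain_iff {V : Type u} {G : SimpleGraph V} {E : V → Set ℝ≥0} {T : ℝ≥0} {v u : V} :
    CausalChain G E 0 T v u ↔ ∃ t ≤ T, Influences G E v u t := by
  constructor
  · rintro ⟨n, p, hp0, hpn, hadj, -, hs⟩
    rcases eq_or_ne n 0 with rfl | hn
    · exact ⟨0, zero_le, by rw [← hp0, ← hpn, hp0]; exact .refl⟩
    · obtain ⟨s, hs0, hlt, hsT, hsE⟩ := hs hn
      have key : ∀ i ≤ n, Influences G E v (p i) (s i) := by
        intro i
        induction i with
        | zero => intro _; rw [hp0, hs0]; exact .refl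
        | succ i ih =>
          exact fun hi => .step (ih (by omega)) (hadj i hi) (hsE _ (by omega) hi) (hlt i hi)
      exact ⟨s n, hsT, hpn ▸ key n le_rfl⟩
  · rintro ⟨t, ht, h⟩
    obtain ⟨n, p, s, hp0, hpn, hadj, hinj, hs0, hs, hsn, hsE⟩ := h.exists_path
    exact ⟨n, p, hp0, hpn, hadj, fun i k hik hk h => absurd h (hinj i k hik hk),
      fun _ => ⟨s, hs0, hs, hsn.trans ht, hsE⟩⟩

/-- The set of vertices with a chain to `u` up to time `s`. -/
def influenceSet {V : Type u} (G : SimpleGraph V) (E : V → Set ℝ≥0) (u : V) (s : ℝ≥0) : Set V :=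
  {v | ∃ t ≤ s, Influences G E v u t}

theorem causalSet_eq {𝒥 : Set ℤ} {V : Type u} (G : SimpleGraph V) (C : ℕ → ℝ≥0 → ℝ≥0)
    {Ω : Type w} (N : V → Ω → Measure (Points 𝒥)) (T : ℝ≥0) (U : Finset V) (ω : Ω) :
    causalSet G C N T U ω = ⋃ u ∈ U, influenceSet G (eventTimes G C N T ω) u T := by
  ext v
  simp [causalSet, influenceSet, causalChain_iff]

theorem mem_influenceSet_self {V : Type u} (G : SimpleGraph V) (E : V → Set ℝ≥0) (u : V)
    (s : ℝ≥0) : u ∈ influenceSet G E u s := ⟨0, zero_le, .refl⟩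

theorem influenceSet_mono {V : Type u} {G : SimpleGraph V} {E : V → Set ℝ≥0} {u : V}
    {s t : ℝ≥0} (h : s ≤ t) : influenceSet G E u s ⊆ influenceSet G E u t :=
  fun _ ⟨r, hr, hv⟩ => ⟨r, hr.trans h, hv⟩

theorem influenceSet_subset_of_adj {V : Type u} {G : SimpleGraph V} {E : V → Set ℝ≥0} {w u : V}
    {r s t : ℝ≥0} (hwu : G.Adj w u) (hr : r ∈ E u) (hsr : s < r) (hrt : r ≤ t) :
    influenceSet G E w s ⊆ influenceSet G E u t :=
  fun _ ⟨_, hq, hv⟩ => ⟨r, hrt, hv.step hwu hr (hq.trans_lt hsr)⟩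

/-- The last part of a chain, inside a time window, stays in one component of the graph of
active vertices. -/
theorem Influences.exists_reachable {V : Type u} {G : SimpleGraph V} {E : V → Set ℝ≥0}
    {a b : ℝ≥0} {A : Set V} (hA : ∀ u, ∀ t ∈ E u, a < t → t ≤ b → u ∈ A) {v u : V} {t : ℝ≥0}
    (h : Influences G E v u t) (hat : a < t) (htb : t ≤ b) :
    ∃ (hu : u ∈ A) (x : A), (G.induce A).Reachable x ⟨u, hu⟩ ∧
      ∃ w, G.Adj w x ∧ v ∈ influenceSet G E w a := by
  induction h with
  | refl => exact absurd hat (by simp)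
  | @step w u s t hws hadj htE hlt ih =>
    have hu : u ∈ A := hA u t htE hat htb
    rcases le_or_gt s a with hs | hs
    · exact ⟨hu, ⟨u, hu⟩, .refl _, w, hadj, s, hs, hws⟩
    · obtain ⟨hw, x, hx, y, hy, hv⟩ := ih hs (hlt.le.trans htb)
      refine ⟨hu, x, hx.trans (SimpleGraph.Adj.reachable ?_), y, hy, hv⟩
      exact hadj

/-- Induction over the windows `(kΔ, (k+1)Δ]`. A chain ending in the window has its last part in the
component of `u` in `A k`; it enters that component from some neighbor `w` of a vertex there, and
what precedes is counted by the influence set of `w` at time `kΔ`. If `u` is not in `A k`, the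
window adds nothing. -/
theorem influenceSet_finite {V : Type u} {G : SimpleGraph V} {E : V → Set ℝ≥0}
    (hG : ∀ v, (G.neighborSet v).Finite) (hE : ∀ u, ∀ t ∈ E u, 0 < t) (Δ : ℝ≥0) (A : ℕ → Set V)
    (hA : ∀ (k : ℕ) u, ∀ t ∈ E u, k * Δ < t → t ≤ (k + 1 : ℕ) * Δ → u ∈ A k)
    (hfin : ∀ k, ∀ c : (G.induce (A k)).ConnectedComponent, c.supp.Finite) (k : ℕ) (u : V) :
    (influenceSet G E u (k * Δ)).Finite := by
  induction k generalizing u with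
  | zero =>
    refine (finite_singleton u).subset ?_
    rintro v ⟨t, ht, h⟩
    cases h with
    | refl => rfl
    | step _ _ htE _ => exact absurd (hE _ _ htE) (by simpa using ht)
  | succ k ih =>
    by_cases hu : u ∈ A k
    · have hc := hfin k ((G.induce (A k)).connectedComponentMk ⟨u, hu⟩)
      refine ((ih u).union (hc.biUnion fun x _ => (hG x).biUnion fun w _ => ih w)).subset ?_
      rintro v ⟨t, ht, h⟩
      rcases le_or_gt t (k * Δ) with htk | htk
      · exact Or.inl ⟨t, htk, h⟩
      · obtain ⟨_, x, hx, w, hw, hv⟩ := h.exists_reachable (hA k) htk ht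
        refine Or.inr (mem_biUnion (x := x) ?_ (mem_biUnion (x := w) hw.symm hv))
        exact SimpleGraph.ConnectedComponent.eq.mpr hx
    · refine (ih u).subset ?_
      rintro v ⟨t, ht, h⟩
      refine ⟨t, le_of_not_gt fun htk => hu ?_, h⟩
      exact (h.exists_reachable (hA k) htk ht).1

/-! ### Propagation of disagreement -/

/-- If a disagreement at `u` by time `s` is always caused by an event of `u` and an earlier
disagreement at `u` or at one of its neighbors, then there is no disagreement at vertices that
are only influenced from within a finite set `A`. -/
theorem not_disagree_of_influenceSet_subset {V : Type u} {G : SimpleGraph V} {E : V → Set ℝ≥0}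
    {A : Set V} (hA : A.Finite) (hE : ∀ u, (E u).Finite) {T : ℝ≥0}
    (D : V → ℝ≥0 → Prop)
    (hD : ∀ u s, s ≤ T → influenceSet G E u s ⊆ A → D u s → ∃ r ∈ E u, r ≤ s ∧
      ∃ w s', (w = u ∨ G.Adj w u) ∧ s' < r ∧ D w s')
    (u : V) (s : ℝ≥0) (hs : s ≤ T) (hu : influenceSet G E u s ⊆ A) : ¬ D u s := by
  have hF : (⋃ u ∈ A, E u).Finite := hA.biUnion fun u _ => hE u
  -- The induction is on the number of event times in `A` up to `s`. The event `r` causing the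
  -- disagreement is counted at `s` but no longer at the earlier time `s' < r`.
  obtain ⟨n, hn⟩ : ∃ n, ((⋃ u ∈ A, E u) ∩ Iic s).ncard = n := ⟨_, rfl⟩
  induction n using Nat.strong_induction_on generalizing u s with
  | _ n ih =>
    intro h
    obtain ⟨r, hr, hrs, w, s', hw, hs', hDw⟩ := hD u s hs hu h
    have hsub : influenceSet G E w s' ⊆ influenceSet G E u s := by
      rcases hw with rfl | hw
      · exact influenceSet_mono (hs'.le.trans hrs)
      · exact influenceSet_subset_of_adj hw hr hs' hrs
    refine ih _ ?_ w s' ((hs'.le.trans hrs).trans hs) (hsub.trans hu) rfl hDw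
    rw [← hn]
    refine ncard_lt_ncard ⟨inter_subset_inter_right _ (Iic_subset_Iic.mpr (hs'.le.trans hrs)),
      fun hcon => ?_⟩ (hF.inter_of_left _)
    have := hcon ⟨mem_biUnion (hu (mem_influenceSet_self G E u s)) hr, hrs⟩
    exact absurd this.2 (not_le.mpr hs')

/-! ### Transport along isomorphisms of balls -/

theorem image_closedNbhd_induce {V : Type u} (G : SimpleGraph V) (B : Set V) (x : B) :
    (Subtype.val '' closedNbhd (G.induce B) x) = closedNbhd G x ∩ B := by
  ext y
  simp only [closedNbhd, mem_image, mem_insert_iff, SimpleGraph.mem_neighborSet,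
    SimpleGraph.comap_adj, mem_inter_iff, Subtype.exists]
  constructor
  · rintro ⟨z, hz, h, rfl⟩
    exact ⟨h.imp (fun h => congrArg Subtype.val h) id, hz⟩
  · rintro ⟨h, hy⟩
    exact ⟨y, hy, h.imp Subtype.ext id, rfl⟩

/-- A degree-preserving isomorphism of induced subgraphs preserves the property that a vertex
has all of its neighbors in the subgraph. -/
theorem closedNbhd_subset_of_iso {V V' : Type u} {G : SimpleGraph V} {G' : SimpleGraph V'}
    {B : Set V} {B' : Set V'} (φ : G'.induce B' ≃g G.induce B) (x : B')
    (hfin : (closedNbhd G' (x : V')).Finite)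
    (hdeg : (closedNbhd G' (x : V')).ncard = (closedNbhd G (φ x : V)).ncard)
    (hsub : closedNbhd G (φ x : V) ⊆ B) : closedNbhd G' (x : V') ⊆ B' := by
  have h1 : (closedNbhd (G'.induce B') x).ncard = (closedNbhd (G.induce B) (φ x)).ncard := by
    rw [← ncard_image_of_injective _ φ.injective]
    congr 1
    ext y
    obtain ⟨y, rfl⟩ := φ.surjective y
    have := φ.map_adj_iff (v := x) (w := y)
    simp only [SimpleGraph.comap_adj, Function.Embedding.subtype_apply] at this
    simp [closedNbhd, φ.injective.eq_iff, this]
  have h2 := congrArg ncard (image_closedNbhd_induce G' B' x)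
  have h3 := congrArg ncard (image_closedNbhd_induce G B (φ x))
  rw [ncard_image_of_injective _ Subtype.val_injective] at h2 h3
  rw [inter_eq_left.mpr hsub] at h3
  -- The part of the neighborhood of `x` inside `B'` is as large as the full neighborhood of `φ x`,
  -- which by the degree condition is as large as the full neighborhood of `x`.
  have : closedNbhd G' (x : V') ∩ B' = closedNbhd G' (x : V') :=
    eq_of_subset_of_ncard_le inter_subset_left (by omega) hfin
  exact inter_eq_left.mp this

/-- The chain is not assumed to stay in `B'`; this is deduced backwards from its end. An event at `φ
u` makes all neighbors of `φ u` influence it, so they lie in `B`; the degree condition then puts all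
neighbors of `u` into `B'`, in particular the predecessor of `u`. -/
theorem Influences.mem_of_subset {V V' : Type u} {G : SimpleGraph V} {G' : SimpleGraph V'}
    {B : Set V} {B' : Set V'} (φ : G'.induce B' ≃g G.induce B)
    (hfin : ∀ x, (closedNbhd G' x).Finite)
    (hdeg : ∀ x : B', (closedNbhd G' (x : V')).ncard = (closedNbhd G (φ x : V)).ncard)
    {E : V → Set ℝ≥0} {E' : V' → Set ℝ≥0} (hE : ∀ x : B', E' x = E (φ x))
    (hE0 : ∀ u, ∀ t ∈ E u, 0 < t) {v u : V'} {t : ℝ≥0}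
    (h : Influences G' E' v u t) (hu : u ∈ B')
    (hsub : influenceSet G E (φ ⟨u, hu⟩ : V) t ⊆ B) :
    ∃ hv : v ∈ B', Influences G E (φ ⟨v, hv⟩ : V) (φ ⟨u, hu⟩ : V) t := by
  induction h with
  | refl => exact ⟨hu, .refl⟩
  | @step w u s t _ hadj htE hlt ih =>
    have htE' : t ∈ E (φ ⟨u, hu⟩ : V) := hE ⟨u, hu⟩ ▸ htE
    have hcl : closedNbhd G (φ ⟨u, hu⟩ : V) ⊆ B := by
      rintro y (rfl | hy)
      · exact (φ ⟨u, hu⟩).2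
      · exact hsub (influenceSet_subset_of_adj (s := 0) hy.symm htE' (hE0 _ _ htE') le_rfl
          (mem_influenceSet_self _ _ _ _))
    have hw : w ∈ B' :=
      closedNbhd_subset_of_iso φ ⟨u, hu⟩ (hfin u) (hdeg _) hcl (Or.inr hadj.symm)
    have hadj' : G.Adj (φ ⟨w, hw⟩ : V) (φ ⟨u, hu⟩ : V) :=
      (φ.map_adj_iff (v := ⟨w, hw⟩) (w := ⟨u, hu⟩)).mpr hadj
    obtain ⟨hv, h⟩ := ih hw ((influenceSet_subset_of_adj hadj' htE' hlt le_rfl).trans hsub)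
    exact ⟨hv, h.step hadj' htE' hlt⟩

/-- A chain that stays in an induced subgraph can be pulled back along an isomorphism. -/
theorem Influences.map_iso {V V' : Type u} {G : SimpleGraph V} {G' : SimpleGraph V'}
    {B : Set V} {B' : Set V'} (φ : G'.induce B' ≃g G.induce B)
    {E : V → Set ℝ≥0} {E' : V' → Set ℝ≥0} (hE : ∀ x : B', E' x = E (φ x))
    {v u : V} {t : ℝ≥0} (h : Influences G E v u t) (hsub : influenceSet G E u t ⊆ B)
    (x : B') (hx : (φ x : V) = u) :
    ∃ y : B', (φ y : V) = v ∧ Influences G' E' y x t := by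
  induction h generalizing x with
  | refl => exact ⟨x, hx, .refl⟩
  | @step w u s t _ hadj htE hlt ih =>
    have hs := influenceSet_subset_of_adj hadj htE hlt le_rfl
    have hwB : w ∈ B := hsub (hs (mem_influenceSet_self _ _ _ _))
    obtain ⟨z, hz⟩ := φ.surjective ⟨w, hwB⟩
    have hz' : (φ z : V) = w := congrArg Subtype.val hz
    obtain ⟨y, hy, h⟩ := ih (hs.trans hsub) z hz'
    refine ⟨y, hy, h.step ?_ ?_ hlt⟩
    · refine φ.map_adj_iff.mp (?_ : G.Adj (φ z : V) (φ x : V))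
      rwa [hz', hx]
    · rw [hE, hx]; exact htE

/-! ### The intensity measure -/

theorem measurableEmbedding_nnreal_coe : MeasurableEmbedding ((↑) : ℝ≥0 → ℝ) :=
  MeasurableEmbedding.subtype_coe measurableSet_Ici

theorem leb_apply (s : Set ℝ≥0) : leb s = volume (((↑) : ℝ≥0 → ℝ) '' s) :=
  measurableEmbedding_nnreal_coe.comap_apply _ _

theorem leb_Ioc (a b : ℝ≥0) : leb (Ioc a b) = ENNReal.ofReal (b - a) := by
  rw [leb_apply, ← Real.volume_Ioc]
  congr 1
  ext x
  simp only [mem_image, mem_Ioc]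
  constructor
  · rintro ⟨y, hy, rfl⟩
    exact_mod_cast hy
  · rintro ⟨h1, h2⟩
    exact ⟨⟨x, a.2.trans h1.le⟩, ⟨h1, h2⟩, rfl⟩

theorem leb_singleton (a : ℝ≥0) : leb {a} = 0 := by
  rw [leb_apply, image_singleton, Real.volume_singleton]

instance : SigmaFinite leb :=
  have : IsFiniteMeasureOnCompacts leb :=
    .comap' _ NNReal.continuous_coe measurableEmbedding_nnreal_coe
  inferInstance

/-- Translation invariance on the half-line; it is what makes the noise after time `a`, moved back
to the origin, a Poisson noise with the same intensity. -/
theorem map_add_leb (a : ℝ≥0) : leb.map (· + a) = leb.restrict (Ici a) := by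
  ext s hs
  rw [Measure.map_apply (by fun_prop) hs, Measure.restrict_apply hs, leb_apply, leb_apply,
    ← measure_preimage_add_right volume (a : ℝ) (_ '' (s ∩ Ici a))]
  congr 1
  ext x
  simp only [mem_image, mem_preimage, mem_inter_iff, mem_Ici]
  constructor
  · rintro ⟨y, hy, rfl⟩
    exact ⟨y + a, ⟨hy, le_add_self⟩, by push_cast; rfl⟩
  · rintro ⟨y, ⟨hy, hay⟩, h⟩
    refine ⟨y - a, by rwa [tsub_add_cancel_of_le hay], ?_⟩
    rw [NNReal.coe_sub hay, h]
    ring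

/-- Translation of the time coordinate. -/
def shift {𝒥 : Set ℤ} (a : ℝ≥0) : Points 𝒥 → Points 𝒥 := Prod.map (· + a) id

theorem measurableEmbedding_shift {𝒥 : Set ℤ} (a : ℝ≥0) :
    MeasurableEmbedding (shift a : Points 𝒥 → Points 𝒥) := by
  have h : MeasurableEmbedding (fun x : ℝ≥0 => x + a) :=
    (by fun_prop : Measurable _).measurableEmbedding (add_left_injective a)
  exact h.prodMap .id

theorem intensity_shift {𝒥 : Set ℤ} (ς : Measure 𝒥) [IsFiniteMeasure ς] (a : ℝ≥0)
    {A : Set (Points 𝒥)} (hA : MeasurableSet A) :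
    intensity ς (shift a '' A) = intensity ς A := by
  have h : (intensity ς).map (shift a) = (intensity ς).restrict (Ici a ×ˢ univ) := by
    unfold intensity shift
    rw [← Measure.map_prod_map _ _ (by fun_prop) measurable_id, map_add_leb, Measure.map_id,
      ← Measure.prod_restrict, Measure.restrict_univ]
  have hm := (measurableEmbedding_shift (𝒥 := 𝒥) a).measurableSet_image.mpr hA
  have h' := congrArg (· (shift a '' A)) h
  simp only [Measure.restrict_apply hm] at h'
  rw [(measurableEmbedding_shift a).map_apply,
    (measurableEmbedding_shift a).injective.preimage_image, inter_eq_left.mpr] at h'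
  · exact h'.symm
  · rintro _ ⟨z, -, rfl⟩
    exact ⟨(le_add_self : a ≤ z.1 + a), mem_univ _⟩

theorem intensity_box {𝒥 : Set ℤ} (ς : Measure 𝒥) [IsFiniteMeasure ς] (a b c : ℝ≥0) :
    intensity ς (Ioc a b ×ˢ Ioc 0 c ×ˢ univ) =
      ENNReal.ofReal (b - a) * (c * ς univ) := by
  rw [intensity, Measure.prod_prod, Measure.prod_prod, leb_Ioc, leb_Ioc]
  simp

/-! ### Poisson processes -/

/-- The probability is `1 - e⁻ʳ(1 + r)`, and `e⁻ʳ ≥ 1 - r`. The quadratic order makes the sum over a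
fine time grid vanish in the limit. -/
theorem poissonMeasure_two_le (r : ℝ≥0) : poissonMeasure r {n | 2 ≤ n} ≤ (r : ℝ≥0∞) ^ 2 := by
  have hc : {n : ℕ | 2 ≤ n} = ({0, 1} : Set ℕ)ᶜ := by
    ext n
    simp
    omega
  have h01 : (poissonMeasure r).real {0, 1} = Real.exp (-r) + Real.exp (-r) * r := by
    rw [show ({0, 1} : Set ℕ) = {0} ∪ {1} from rfl,
      measureReal_union (by simp) (measurableSet_singleton _),
      poissonMeasure_real_singleton, poissonMeasure_real_singleton]
    simp
  have h : (poissonMeasure r).real {n | 2 ≤ n} ≤ (r : ℝ) ^ 2 := by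
    rw [hc, probReal_compl_eq_one_sub (by measurability), h01]
    have := Real.add_one_le_exp (-(r : ℝ))
    nlinarith [r.2, NNReal.coe_nonneg r]
  refine ((ENNReal.le_ofReal_iff_toReal_le (measure_ne_top _ _) (by positivity)).mpr h).trans_eq ?_
  rw [ENNReal.ofReal_pow (NNReal.coe_nonneg r), ENNReal.ofReal_coe_nnreal]

section

variable {Ω : Type*} [MeasurableSpace Ω] {P : Measure Ω} {E : Type*} [TopologicalSpace E]
  [MeasurableSpace E] {ζ : Measure E} {N : Ω → Measure E}

theorem IsPoissonProcess.measurable_apply (hN : IsPoissonProcess P ζ N) {A : Set E}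
    (hA : MeasurableSet A) : Measurable (fun ω => N ω A) :=
  (Measure.measurable_coe hA).comp hN.measurable

theorem IsPoissonProcess.measure_preimage (hN : IsPoissonProcess P ζ N) {A : Set E}
    (hA : MeasurableSet A) (hζ : ζ A ≠ ∞) {B : Set ℝ≥0∞} (hB : MeasurableSet B) :
    P {ω | N ω A ∈ B} = poissonMeasure (ζ A).toNNReal {n : ℕ | (n : ℝ≥0∞) ∈ B} := by
  have h := congrArg (· B) (hN.law A hA hζ)
  simp only [Measure.map_apply (hN.measurable_apply hA) hB,
    Measure.map_apply (Measurable.of_discrete (f := fun n : ℕ => (n : ℝ≥0∞))) hB] at h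
  exact h

theorem IsPoissonProcess.ae_eq_zero (hN : IsPoissonProcess P ζ N) {A : Set E}
    (hA : MeasurableSet A) (hζ : ζ A = 0) : ∀ᵐ ω ∂P, N ω A = 0 := by
  have h := hN.measure_preimage hA (by simp [hζ]) (B := {0}ᶜ) (by measurability)
  rw [ae_iff]
  refine h.trans ?_
  rw [hζ]
  refine (measure_mono_null (t := {(0 : ℕ)}ᶜ) (fun n hn => by simpa using hn) ?_)
  rw [prob_compl_eq_zero_iff (by measurability)]
  simp [poissonMeasure_singleton]

theorem IsPoissonProcess.ae_lt_top (hN : IsPoissonProcess P ζ N) {A : Set E}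
    (hA : MeasurableSet A) (hζ : ζ A ≠ ∞) : ∀ᵐ ω ∂P, N ω A < ∞ := by
  have h := hN.measure_preimage hA hζ (B := {∞}) (by measurability)
  rw [ae_iff]
  simpa using h

theorem IsPoissonProcess.measure_two_le (hN : IsPoissonProcess P ζ N) {A : Set E}
    (hA : MeasurableSet A) (hζ : ζ A ≠ ∞) : P {ω | 2 ≤ N ω A} ≤ ζ A ^ 2 := by
  refine (hN.measure_preimage hA hζ (B := Ici 2) measurableSet_Ici).trans_le ?_
  have : {n : ℕ | (n : ℝ≥0∞) ∈ Ici 2} = {n | 2 ≤ n} := by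
    ext n
    simp only [mem_Ici, mem_ofPred_eq]
    exact_mod_cast Iff.rfl
  rw [this]
  refine (poissonMeasure_two_le _).trans_eq ?_
  rw [ENNReal.coe_toNNReal hζ]

/-- Countability makes the supporting set measurable where singletons are, so that masses become
cardinalities. -/
theorem IsSimplePointMeasure.exists_countable {μ : Measure E} [SigmaCompactSpace E]
    (h : IsSimplePointMeasure μ) : ∃ S : Set E, S.Countable ∧ μ = Measure.count.restrict S := by
  obtain ⟨S, hS, rfl⟩ := h
  refine ⟨S, ?_, rfl⟩
  have : S = ⋃ n, S ∩ compactCovering E n := by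
    rw [← inter_iUnion, iUnion_compactCovering, inter_univ]
  rw [this]
  exact countable_iUnion fun n => (hS _ (isCompact_compactCovering E n)).countable

end

/-- Almost surely no two points of the process in a box of finite intensity are simultaneous. -/
theorem IsPoissonProcess.ae_simultaneous_lt_two {Ω : Type*} [MeasurableSpace Ω] {P : Measure Ω}
    {𝒥 : Set ℤ} {ς : Measure 𝒥} [IsFiniteMeasure ς] {N : Ω → Measure (Points 𝒥)}
    (hN : IsPoissonProcess P (intensity ς) N) (T c : ℝ≥0) :
    ∀ᵐ ω ∂P, ∀ t ∈ Ioc 0 T, N ω ({t} ×ˢ Ioc 0 c ×ˢ univ) < 2 := by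
  rw [ae_iff]
  set K : ℝ≥0 := (T * (c * ς univ)).toNNReal with hK
  have hKe : (K : ℝ≥0∞) = T * (c * ς univ) := by
    rw [hK, ENNReal.coe_toNNReal (by finiteness)]
  -- Two simultaneous points share a cell of the grid with `n + 1` cells. Each cell has intensity `K
  -- / (n + 1)`, hence contains two points with probability at most the square of this, and summing
  -- leaves `K² / (n + 1)`.
  have hbound : ∀ n : ℕ, P {ω | ¬ ∀ t ∈ Ioc 0 T, N ω ({t} ×ˢ Ioc 0 c ×ˢ univ) < 2} ≤
      ((K ^ 2 / (n + 1 : ℕ) : ℝ≥0) : ℝ≥0∞) := by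
    intro n
    have hn : (0 : ℝ≥0) < (n + 1 : ℕ) := by exact_mod_cast n.succ_pos
    let τ : ℕ → ℝ≥0 := fun i => i * (T / (n + 1 : ℕ))
    have hsub : {ω | ¬ ∀ t ∈ Ioc 0 T, N ω ({t} ×ˢ Ioc 0 c ×ˢ univ) < 2} ⊆
        ⋃ i ∈ Finset.range (n + 1),
          {ω | 2 ≤ N ω (Ioc (τ i) (τ (i + 1)) ×ˢ Ioc 0 c ×ˢ univ)} := by
      intro ω hω
      simp only [mem_ofPred_eq, not_forall, not_lt] at hω
      obtain ⟨t, ht, h2⟩ := hω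
      have hex : ∃ i, t ≤ τ i := ⟨n + 1, by
        simp only [τ]; rw [mul_div_cancel₀ _ hn.ne']; exact ht.2⟩
      classical
      have hfind := Nat.find_spec hex
      obtain ⟨i, hi⟩ : ∃ i, Nat.find hex = i + 1 := by
        refine Nat.exists_eq_succ_of_ne_zero fun h => ?_
        rw [h] at hfind
        simp only [τ, Nat.cast_zero, zero_mul] at hfind
        exact absurd ht.1 (not_lt.mpr hfind)
      rw [hi] at hfind
      have hlt : τ i < t := not_le.mp (Nat.find_min hex (by omega))
      have hin : i < n + 1 := by
        have := Nat.find_min' hex (m := n + 1) (by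
          simp only [τ]; rw [mul_div_cancel₀ _ hn.ne']; exact ht.2)
        omega
      refine mem_biUnion (Finset.mem_coe.mpr (Finset.mem_range.mpr hin)) (h2.trans ?_)
      exact measure_mono (prod_mono (singleton_subset_iff.mpr ⟨hlt, hfind⟩) subset_rfl)
    have hint : ∀ i, intensity ς (Ioc (τ i) (τ (i + 1)) ×ˢ Ioc 0 c ×ˢ univ) =
        ((K / (n + 1 : ℕ) : ℝ≥0) : ℝ≥0∞) := by
      intro i
      have hd : ((τ (i + 1) : ℝ) - τ i) = ((T / (n + 1 : ℕ) : ℝ≥0) : ℝ) := by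
        simp only [τ]; push_cast; ring
      rw [intensity_box, hd, ENNReal.ofReal_coe_nnreal, ENNReal.coe_div hn.ne',
        ENNReal.coe_div hn.ne', hKe, ENNReal.mul_div_right_comm]
    calc _ ≤ ∑ i ∈ Finset.range (n + 1),
          P {ω | 2 ≤ N ω (Ioc (τ i) (τ (i + 1)) ×ˢ Ioc 0 c ×ˢ univ)} :=
          (measure_mono hsub).trans (measure_biUnion_finset_le _ _)
      _ ≤ ∑ i ∈ Finset.range (n + 1), ((K / (n + 1 : ℕ) : ℝ≥0) : ℝ≥0∞) ^ 2 := by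
          refine Finset.sum_le_sum fun i _ => ?_
          rw [← hint i]
          refine hN.measure_two_le (by measurability) ?_
          rw [hint]
          exact ENNReal.coe_ne_top
      _ = _ := by
          rw [Finset.sum_const, Finset.card_range, nsmul_eq_mul]
          norm_cast
          field_simp
  refine le_antisymm (ge_of_tendsto' (x := atTop) ?_ hbound) zero_le
  rw [← ENNReal.coe_zero, ENNReal.tendsto_coe]
  refine Tendsto.comp (g := fun n : ℕ => K ^ 2 / (n : ℝ≥0)) ?_ (tendsto_add_atTop_nat 1)
  rw [← NNReal.tendsto_coe]
  simpa using tendsto_const_div_atTop_nhds_zero_nat ((K : ℝ) ^ 2)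

/-- Almost sure regularity of the points of a Poisson process below a given level. -/
theorem IsPoissonProcess.ae_regular {Ω : Type*} [MeasurableSpace Ω] {P : Measure Ω}
    {𝒥 : Set ℤ} {ς : Measure 𝒥} [IsFiniteMeasure ς] {N : Ω → Measure (Points 𝒥)}
    (hN : IsPoissonProcess P (intensity ς) N) (T c : ℝ≥0) :
    ∀ᵐ ω ∂P, {t | t ∈ Ioc 0 T ∧ N ω ({t} ×ˢ Ioc 0 c ×ˢ univ) = 1}.Finite ∧
      ∀ᵐ z ∂(N ω), z.1 ∈ Ioc 0 T → z.2.1 ≤ c →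
        0 < z.2.1 ∧ N ω ({z.1} ×ˢ Ioc 0 c ×ˢ univ) = 1 := by
  -- The jump condition `r ≤ rate` admits level `0`, whereas the thinned process counts levels in
  -- `(0, c]`; no point sits on the discrepancy.
  have h0 : ∀ᵐ ω ∂P, N ω (univ ×ˢ {0} ×ˢ univ) = 0 := by
    refine hN.ae_eq_zero (by measurability) ?_
    rw [intensity, Measure.prod_prod, Measure.prod_prod, leb_singleton]
    simp
  have h1 : ∀ᵐ ω ∂P, N ω (Ioc 0 T ×ˢ Ioc 0 c ×ˢ univ) < ∞ := by
    refine hN.ae_lt_top (by measurability) ?_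
    rw [intensity_box]
    finiteness
  filter_upwards [h0, h1, hN.ae_simultaneous_lt_two T c] with ω h0 h1 h2
  obtain ⟨S, hS, hNS⟩ := (hN.simple ω).exists_countable
  have happly : ∀ A : Set (Points 𝒥), MeasurableSet A → N ω A = (A ∩ S).encard := by
    intro A hA
    rw [hNS, Measure.restrict_apply hA, Measure.count_apply (hA.inter hS.measurableSet)]
  have hbox : ∀ t, MeasurableSet ({t} ×ˢ Ioc 0 c ×ˢ univ : Set (Points 𝒥)) := fun t => by
    measurability
  constructor
  · rw [happly _ (by measurability)] at h1
    have hfin : (Ioc 0 T ×ˢ Ioc 0 c ×ˢ univ ∩ S : Set (Points 𝒥)).Finite := by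
      rw [← encard_lt_top_iff]
      exact_mod_cast h1
    refine (hfin.image Prod.fst).subset ?_
    rintro t ⟨ht, h⟩
    rw [happly _ (hbox t)] at h
    have hne : ({t} ×ˢ Ioc 0 c ×ˢ univ ∩ S : Set (Points 𝒥)).Nonempty := by
      rw [← encard_ne_zero]
      intro h'
      simp [h'] at h
    obtain ⟨z, ⟨hz1, hz2⟩, hzS⟩ := hne
    rw [mem_singleton_iff] at hz1
    exact ⟨z, ⟨⟨hz1 ▸ ht, hz2⟩, hzS⟩, hz1⟩
  · have hz0 : ∀ᵐ z ∂(N ω), z ∉ (univ ×ˢ {0} ×ˢ univ : Set (Points 𝒥)) := by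
      rwa [ae_iff, show {z : Points 𝒥 | ¬ z ∉ (univ ×ˢ {0} ×ˢ univ : Set (Points 𝒥))} =
        univ ×ˢ {0} ×ˢ univ by ext; simp]
    have hzS : ∀ᵐ z ∂(N ω), z ∈ S := by
      rw [hNS]
      exact ae_restrict_mem hS.measurableSet
    filter_upwards [hz0, hzS] with z hz0 hzS hzT hzc
    have hpos : 0 < z.2.1 := by
      rw [pos_iff_ne_zero]
      exact fun h => hz0 ⟨mem_univ _, h, mem_univ _⟩
    refine ⟨hpos, ?_⟩
    have hlt := h2 z.1 hzT
    rw [happly _ (hbox _)] at hlt ⊢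
    have hge : 1 ≤ ({z.1} ×ˢ Ioc 0 c ×ˢ univ ∩ S : Set (Points 𝒥)).encard :=
      one_le_encard_iff_nonempty.mpr ⟨z, ⟨rfl, ⟨hpos, hzc⟩, mem_univ _⟩, hzS⟩
    have hlt' : ({z.1} ×ˢ Ioc 0 c ×ˢ univ ∩ S : Set (Points 𝒥)).encard < 2 := by
      exact_mod_cast hlt
    have : ({z.1} ×ˢ Ioc 0 c ×ˢ univ ∩ S : Set (Points 𝒥)).encard = 1 :=
      le_antisymm (Order.le_of_lt_add_one (by simpa [one_add_one_eq_two] using hlt')) hge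
    simp [this]

/-! ### Time shifts of the noise -/

theorem IsSimplePointMeasure.comap_shift {𝒥 : Set ℤ} {μ : Measure (Points 𝒥)}
    (h : IsSimplePointMeasure μ) (a : ℝ≥0) : IsSimplePointMeasure (μ.comap (shift a)) := by
  obtain ⟨S, hS, rfl⟩ := h
  have hinj := (measurableEmbedding_shift (𝒥 := 𝒥) a).injective
  refine ⟨shift a ⁻¹' S, fun K hK => ?_, ?_⟩
  · have hcont : Continuous (shift a : Points 𝒥 → Points 𝒥) := by
      unfold shift
      fun_prop
    refine ((hS _ (hK.image hcont)).preimage hinj.injOn).subset ?_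
    rintro z ⟨hz, hzK⟩
    exact ⟨hz, mem_image_of_mem _ hzK⟩
  · rw [(measurableEmbedding_shift a).comap_restrict]
    congr 1
    ext A hA
    rw [(measurableEmbedding_shift a).comap_apply, Measure.count_injective_image hinj]

theorem IsPoissonProcess.comap_shift {Ω : Type*} [MeasurableSpace Ω] {P : Measure Ω}
    {𝒥 : Set ℤ} {ς : Measure 𝒥} [IsFiniteMeasure ς] {N : Ω → Measure (Points 𝒥)}
    (hN : IsPoissonProcess P (intensity ς) N) (a : ℝ≥0) :
    IsPoissonProcess P (intensity ς) (fun ω => (N ω).comap (shift a)) := by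
  have hs := measurableEmbedding_shift (𝒥 := 𝒥) a
  refine ⟨fun ω => (hN.simple ω).comap_shift a, ?_, fun A hA hζ => ?_, fun k A hA hd => ?_⟩
  · refine Measure.measurable_of_measurable_coe _ fun A hA => ?_
    simp only [hs.comap_apply]
    exact hN.measurable_apply (hs.measurableSet_image.mpr hA)
  · simp only [hs.comap_apply]
    rw [← intensity_shift ς a hA] at hζ ⊢
    exact hN.law _ (hs.measurableSet_image.mpr hA) hζ
  · simp only [hs.comap_apply]
    exact hN.indep k (fun i => shift a '' A i) (fun i => hs.measurableSet_image.mpr (hA i))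
      fun i j hij => (disjoint_image_iff hs.injective).mpr (hd hij)

/-- Finite dissociability quantifies over all realizations of the noise, so it may be applied to the
shifted ones as well. -/
theorem IsPoissonNoise.comap_shift {Ω : Type*} [MeasurableSpace Ω] {P : Measure Ω}
    {𝒥 : Set ℤ} {ς : Measure 𝒥} [IsFiniteMeasure ς] {V : Type*} {N : V → Ω → Measure (Points 𝒥)}
    (hN : IsPoissonNoise P ς N) (a : ℝ≥0) :
    IsPoissonNoise P ς (fun v ω => (N v ω).comap (shift a)) := by
  refine ⟨fun v => (hN.poisson v).comap_shift a, ?_⟩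
  refine hN.indep.comp (fun _ μ => μ.comap (shift a)) fun _ => ?_
  refine Measure.measurable_of_measurable_coe _ fun A hA => ?_
  simp only [(measurableEmbedding_shift a).comap_apply]
  exact Measure.measurable_coe ((measurableEmbedding_shift a).measurableSet_image.mpr hA)

/-! ### Measurability of the causal set -/

theorem measurableSet_noiseFiltration_of_measure_zero {Ω : Type*} [MeasurableSpace Ω]
    {P : Measure Ω} {𝒥 : Set ℤ} {V : Type*} {N : V → Ω → Measure (Points 𝒥)} {t : ℝ≥0} {A : Set Ω}
    (hA : P A = 0) : MeasurableSet[noiseFiltration P N t] A := by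
  refine MeasurableSpace.measurableSet_iInf.mpr fun s =>
    MeasurableSpace.measurableSet_iInf.mpr fun _ => ?_
  exact (le_sup_right : _ ≤ _ ⊔ MeasurableSpace.generateFrom {A | P A = 0}) _
    (MeasurableSpace.measurableSet_generateFrom hA)

theorem measurable_noiseFiltration {Ω : Type*} [MeasurableSpace Ω]
    {P : Measure Ω} {𝒥 : Set ℤ} {V : Type*} {N : V → Ω → Measure (Points 𝒥)} {t : ℝ≥0} (v : V)
    {A : Set (Points 𝒥)} (hA : MeasurableSet A) (hAt : A ⊆ Iic t ×ˢ univ) :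
    Measurable[noiseFiltration P N t] (fun ω => N v ω A) := by
  rw [measurable_iff_comap_le]
  refine le_iInf₂ fun s hs => le_trans ?_ le_sup_left
  have hAs : MeasurableSet A ∧ A ⊆ Iic s ×ˢ univ :=
    ⟨hA, hAt.trans (prod_mono (Iic_subset_Iic.mpr hs.le) subset_rfl)⟩
  exact le_iSup_of_le v (le_iSup₂_of_le A hAs le_rfl)

/-- The augmented filtration contains all null sets, and `A` differs from `B` by null sets only. -/
theorem measurableSet_noiseFiltration_congr {Ω : Type*} [MeasurableSpace Ω]
    {P : Measure Ω} {𝒥 : Set ℤ} {V : Type*} {N : V → Ω → Measure (Points 𝒥)} {t : ℝ≥0} {A B : Set Ω}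
    (hB : MeasurableSet[noiseFiltration P N t] B) (h : ∀ᵐ ω ∂P, ω ∈ A ↔ ω ∈ B) :
    MeasurableSet[noiseFiltration P N t] A := by
  have hA : A = (B \ (B \ A)) ∪ (A \ B) := by
    ext ω
    simp only [mem_union, Set.mem_sdiff]
    tauto
  rw [ae_iff] at h
  rw [hA]
  refine (hB.diff ?_).union ?_ <;>
  refine measurableSet_noiseFiltration_of_measure_zero (measure_mono_null ?_ h)
  · exact fun ω hω h => hω.2 (h.mpr hω.1)
  · exact fun ω hω h => hω.2 (h.mp hω.1)

/-- The event that a chain of length `n` leads from `v` to `u` up to time `q`, expressed through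
the events `F u a b` that `u` has an event time in `(a, b]`. -/
def chainEvent {V : Type u} {Ω : Type w} (G : SimpleGraph V) (F : V → ℝ≥0 → ℝ≥0 → Set Ω)
    (Q : Set ℝ≥0) (v : V) : ℕ → V → ℝ≥0 → Set Ω
  | 0, u, _ => {_ω | v = u}
  | n + 1, u, q => ⋃ y ∈ G.neighborSet u, ⋃ r ∈ Q ∩ Iio q, chainEvent G F Q v n y r ∩ F u r q

theorem measurableSet_chainEvent {V : Type u} [Countable V] {Ω : Type w} {m : MeasurableSpace Ω}
    (G : SimpleGraph V) {F : V → ℝ≥0 → ℝ≥0 → Set Ω} {Q : Set ℝ≥0} (hQ : Q.Countable) {T : ℝ≥0}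
    (hF : ∀ u a b, b ≤ T → MeasurableSet (F u a b)) (v : V) (n : ℕ) (u : V) (q : ℝ≥0)
    (hq : q ≤ T) : MeasurableSet (chainEvent G F Q v n u q) := by
  induction n generalizing u q with
  | zero => exact .const _
  | succ n ih =>
    refine .biUnion (to_countable _) fun y _ => .biUnion (hQ.mono inter_subset_left) fun r hr => ?_
    exact (ih y r (hr.2.le.trans hq)).inter (hF u r q hq)

/-- Between consecutive times `s < t` of a chain lies some `r ∈ Q`: the earlier part is complete by
`r` and the next event falls in `(r, q]`. Conversely, an event in `(r, q]` is later than anything up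
to `r`, so the times increase strictly. -/
theorem exists_mem_chainEvent_iff {V : Type u} {Ω : Type w} {G : SimpleGraph V}
    {F : V → ℝ≥0 → ℝ≥0 → Set Ω} {Q : Set ℝ≥0} (hQ : Dense Q) {E : V → Set ℝ≥0} {T : ℝ≥0} {ω : Ω}
    (hF : ∀ u a b, b ≤ T → (ω ∈ F u a b ↔ ∃ t ∈ E u, a < t ∧ t ≤ b)) {v u : V} {q : ℝ≥0}
    (hq : q ≤ T) : (∃ n, ω ∈ chainEvent G F Q v n u q) ↔ v ∈ influenceSet G E u q := by
  constructor
  · rintro ⟨n, hn⟩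
    induction n generalizing u q with
    | zero =>
      obtain rfl : v = u := hn
      exact mem_influenceSet_self _ _ _ _
    | succ n ih =>
      simp only [chainEvent, mem_iUnion] at hn
      obtain ⟨y, hy, r, hr, hyr, hFu⟩ := hn
      obtain ⟨t, htE, hrt, htq⟩ := (hF u r q hq).mp hFu
      exact influenceSet_subset_of_adj hy.symm htE hrt htq (ih (hr.2.le.trans hq) hyr)
  · rintro ⟨t, htq, h⟩
    induction h generalizing q with
    | refl => exact ⟨0, rfl⟩
    | @step y u s t _ hadj htE hlt ih =>
      obtain ⟨r, hrQ, hsr, hrt⟩ := hQ.exists_between hlt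
      have hrq := hrt.trans_le htq
      obtain ⟨n, hn⟩ := ih (hrq.le.trans hq) hsr.le
      refine ⟨n + 1, ?_⟩
      simp only [chainEvent, mem_iUnion]
      exact ⟨y, hadj.symm, r, ⟨hrQ, hrq⟩, hn, (hF u r q hq).mpr ⟨t, htE, hrt, htq⟩⟩

theorem eventTimes_pos {𝒥 : Set ℤ} {V : Type u} {Ω : Type w}
    {N : V → Ω → Measure (Points 𝒥)} (G : SimpleGraph V) (C : ℕ → ℝ≥0 → ℝ≥0) (T : ℝ≥0) (ω : Ω) (u : V) :
    ∀ t ∈ eventTimes G C N T ω u, 0 < t := fun _ ht => ht.1.1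

/-- An event time requires mass exactly one at a single instant; by regularity almost every relevant
point provides this, so positive mass on an interval detects events. -/
theorem thinned_Ioc_pos_iff {𝒥 : Set ℤ} {V : Type u} {Ω : Type w}
    {N : V → Ω → Measure (Points 𝒥)} {G : SimpleGraph V} {C : ℕ → ℝ≥0 → ℝ≥0} {T : ℝ≥0} {ω : Ω} {v : V}
    (h : ∀ᵐ z ∂(N v ω), z.1 ∈ Ioc 0 T → z.2.1 ≤ C (closedNbhd G v).ncard T →
      z.1 ∈ eventTimes G C N T ω v) {a b : ℝ≥0} (hb : b ≤ T) :
    0 < thinned G C N T v ω (Ioc a b) ↔ ∃ t ∈ eventTimes G C N T ω v, a < t ∧ t ≤ b := by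
  constructor
  · contrapose!
    intro hne
    rw [nonpos_iff_eq_zero, thinned, measure_eq_zero_iff_ae_notMem]
    filter_upwards [h] with z hz hmem
    obtain ⟨⟨haz, hzb⟩, hzc, -⟩ := hmem
    exact not_lt.mpr hzb
      (hne z.1 (hz ⟨bot_le.trans_lt haz, hzb.trans hb⟩ hzc.2) haz)
  · rintro ⟨t, ht, hat, htb⟩
    have h1 : (0 : ℝ≥0∞) < thinned G C N T v ω {t} := by rw [ht.2]; exact one_pos
    exact h1.trans_le (measure_mono (prod_mono (singleton_subset_iff.mpr ⟨hat, htb⟩) subset_rfl))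

section

variable {𝒥 : Set ℤ} {ς : Measure 𝒥} {V : Type u} {Ω : Type w} [MeasurableSpace Ω]
  {P : Measure Ω} {N : V → Ω → Measure (Points 𝒥)}

/-- Almost surely the thinned processes have finitely many events, and every point below the
relevant level contributes an event time. -/
theorem IsPoissonNoise.ae_regular [Countable V] [IsFiniteMeasure ς]
    (hN : IsPoissonNoise P ς N) (G : SimpleGraph V) (C : ℕ → ℝ≥0 → ℝ≥0) (T : ℝ≥0) :
    ∀ᵐ ω ∂P, ∀ v, (eventTimes G C N T ω v).Finite ∧
      ∀ᵐ z ∂(N v ω), z.1 ∈ Ioc 0 T → z.2.1 ≤ C (closedNbhd G v).ncard T →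
        z.1 ∈ eventTimes G C N T ω v := by
  rw [ae_all_iff]
  intro v
  filter_upwards [(hN.poisson v).ae_regular T (C (closedNbhd G v).ncard T)] with ω h
  refine ⟨h.1, ?_⟩
  filter_upwards [h.2] with z hz h1 h2
  exact ⟨h1, (hz h1 h2).2⟩

theorem measurableSet_causalSet_subset [Countable V] [IsFiniteMeasure ς]
    (hN : IsPoissonNoise P ς N) (G : SimpleGraph V) (C : ℕ → ℝ≥0 → ℝ≥0) (T : ℝ≥0)
    (U U' : Finset V) :
    MeasurableSet[noiseFiltration P N T] {ω | causalSet G C N T U ω ⊆ (U' : Set V)} := by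
  obtain ⟨Q, hQc, hQ⟩ := TopologicalSpace.exists_countable_dense ℝ≥0
  let F : V → ℝ≥0 → ℝ≥0 → Set Ω := fun u a b => {ω | 0 < thinned G C N T u ω (Ioc a b)}
  have hF : ∀ u a b, b ≤ T → MeasurableSet[noiseFiltration P N T] (F u a b) := by
    intro u a b hb
    refine measurableSet_lt measurable_const (measurable_noiseFiltration u ?_ ?_)
    · exact measurableSet_Ioc.prod (measurableSet_Ioc.prod .univ)
    · exact prod_mono (fun t ht => ht.2.trans hb) (subset_univ _)
  refine measurableSet_noiseFiltration_congr
    -- No vertex outside `U'` has a chain to `U`, written with countably many chain events. The two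
    -- events agree only almost surely, which the augmentation absorbs.
    (B := ⋂ v ∈ (U' : Set V)ᶜ, ⋂ u ∈ (U : Set V), ⋂ n, (chainEvent G F Q v n u T)ᶜ) ?_ ?_
  · refine .biInter (to_countable _) fun v _ => .biInter (to_countable _) fun u _ => .iInter
      fun n => .compl ?_
    exact measurableSet_chainEvent G hQc hF v n u T le_rfl
  · filter_upwards [hN.ae_regular G C T] with ω hω
    have key : ∀ v u, (∃ n, ω ∈ chainEvent G F Q v n u T) ↔
        v ∈ influenceSet G (eventTimes G C N T ω) u T := fun v u =>
      exists_mem_chainEvent_iff (F := F) (ω := ω) hQ (fun u a b hb => thinned_Ioc_pos_iff (hω u).2 hb) le_rfl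
    simp only [mem_iInter, mem_compl_iff]
    refine Iff.trans (b := ∀ u ∈ U, influenceSet G (eventTimes G C N T ω) u T ⊆ U') ?_
      ⟨fun h v hv u hu n hn => hv (h u hu ((key v u).mp ⟨n, hn⟩)), fun h u hu v hvu => ?_⟩
    · rw [causalSet_eq, iUnion₂_subset_iff]
    · obtain ⟨n, hn⟩ := (key v u).mpr hvu
      exact by_contra fun hv => h v hv u hu n hn

/-! ### Finiteness of the causal set -/

theorem FinitelyDissociable.ae_finite_causalSet [IsProbabilityMeasure P] [IsFiniteMeasure ς]
    {G : SimpleGraph V} {C : ℕ → ℝ≥0 → ℝ≥0} (hG : FinitelyDissociable.{u, w} ς C G)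
    (hlf : ∀ v, (G.neighborSet v).Finite) (hN : IsPoissonNoise P ς N) (T : ℝ≥0) :
    ∀ᵐ ω ∂P, ∀ U : Finset V, (causalSet G C N T U ω).Finite := by
  simp only [causalSet_eq]
  suffices h : ∀ᵐ ω ∂P, ∀ u, (influenceSet G (eventTimes G C N T ω) u T).Finite by
    filter_upwards [h] with ω hω U
    exact U.finite_toSet.biUnion fun u _ => hω u
  rcases eq_zero_or_pos T with rfl | hT
  · refine ae_of_all _ fun ω u => ?_
    -- Dissociability says nothing for `T = 0`. There windows of length `0` are empty, and only
    -- trivial chains exist.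
    have h := influenceSet_finite hlf (eventTimes_pos (N := N) G C 0 ω) 0 (fun _ => ∅)
      (fun k u t _ h1 h2 => by simp at h1 h2; exact absurd h1 (not_lt.mpr h2.le))
      (fun k c => toFinite _) 0 u
    simpa using h
  obtain ⟨Δ, hΔ, -, hdiss⟩ := hG T hT
  have hall : ∀ᵐ ω ∂P, ∀ k : ℕ,
      Dissociates G C (fun v ω => (N v ω).comap (shift (k * Δ))) T Δ ω :=
    ae_all_iff.mpr fun k => hdiss Ω _ P inferInstance _ (hN.comap_shift _)
  filter_upwards [hall] with ω hω u
  -- Enough windows to cover `[0, T]`. The vertices active in window `k` are those for which the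
  -- noise shifted by `kΔ` has an event in `(0, Δ]`.
  obtain ⟨k, hk⟩ := exists_nat_ge (T / Δ)
  refine (influenceSet_finite hlf (eventTimes_pos G C T ω) Δ _ ?_ hω k u).subset
    (influenceSet_mono ((div_le_iff₀ hΔ).mp hk))
  intro k u t ht hkt htk
  have h1 : (0 : ℝ≥0∞) < thinned G C N T u ω {t} := by rw [ht.2]; exact one_pos
  refine h1.trans_le ?_
  simp only [thinned, (measurableEmbedding_shift _).comap_apply]
  refine measure_mono ?_
  rintro ⟨s, z⟩ ⟨hs, hz⟩
  obtain rfl : s = t := hs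
  refine ⟨(s - k * Δ, z), ⟨⟨tsub_pos_of_lt hkt, ?_⟩, hz⟩, ?_⟩
  · rw [tsub_le_iff_left]
    push_cast at htk
    linarith [add_mul (k : ℝ≥0) 1 Δ]
  · simp [shift, tsub_add_cancel_of_le hkt.le]

end

/-! ### Localization -/

theorem MarkedGraph.closedNbhd_finite {V : Type u} {Ke Kv : Type*} (G : MarkedGraph V Ke Kv)
    (v : V) : (closedNbhd G.graph v).Finite :=
  (G.locallyFinite v).insert v

section

variable {𝒳 𝒥 : Set ℤ} {Ke Kv : Type*} [MeasurableSpace Ke] [MeasurableSpace Kv]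
  (M : Model.{u} 𝒳 𝒥 Ke Kv) {V : Type u} (G : MarkedGraph V Ke Kv)

/-- If `W` contains `cl(u)`, then the rooted marked graphs `G[W][cl(u)]` and `G[cl(u)]` are
isomorphic, so that they lead to the same jump rate. -/
theorem Model.jumpRate_induce {W : Set V} {u : V} (hW : closedNbhd G.graph u ⊆ W) (j : 𝒥)
    {t : ℝ≥0} (ht : 0 < t) (x : W → Path 𝒳) :
    M.jumpRate (G.induce W) ⟨u, hW (mem_insert _ _)⟩ j t x =
      M.rate j (localStar G u) t (fun a : closedNbhd G.graph u => x ⟨a, hW a.2⟩)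
        (G.induce (closedNbhd G.graph u)).edgeMark
        (G.induce (closedNbhd G.graph u)).vertexMark := by
  have hmem : ∀ a : W, a ∈ closedNbhd (G.induce W).graph ⟨u, hW (mem_insert _ _)⟩ ↔
      (a : V) ∈ closedNbhd G.graph u := fun a => or_congr Subtype.ext_iff Iff.rfl
  let φ : (localStar G u).graph ≃g
      (localStar (G.induce W) ⟨u, hW (mem_insert _ _)⟩).graph :=
    { toFun := fun a => ⟨⟨a.1, hW a.2⟩, (hmem _).mpr a.2⟩
      invFun := fun a => ⟨a.1.1, (hmem _).mp a.2⟩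
      left_inv := fun _ => rfl
      right_inv := fun _ => rfl
      map_rel_iff' := Iff.rfl }
  refine (M.rate_class j _ _ φ rfl t ht _ _ _).trans ?_
  congr 1
  funext a
  refine congrArg G.edgeMark (Subtype.ext ?_)
  obtain ⟨a, ha⟩ := a
  induction a using Sym2.ind with
  | _ a b => rfl

/-- Both rates are that of the star of `u` in `G`. Predictability reduces agreement to times
strictly before `t`, so a disagreement can be traced to a strictly earlier one. -/
theorem Model.jumpRate_induce_congr {B W : Set V} {u : V} (hB : closedNbhd G.graph u ⊆ B)
    (hW : closedNbhd G.graph u ⊆ W) (j : 𝒥) {t : ℝ≥0} (ht : 0 < t) (x : W → Path 𝒳)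
    (y : B → Path 𝒳)
    (hxy : ∀ v (hv : v ∈ closedNbhd G.graph u), ∀ s < t, x ⟨v, hW hv⟩ s = y ⟨v, hB hv⟩ s) :
    M.jumpRate (G.induce W) ⟨u, hW (mem_insert _ _)⟩ j t x =
      M.jumpRate (G.induce B) ⟨u, hB (mem_insert _ _)⟩ j t y := by
  rw [M.jumpRate_induce G hW j ht, M.jumpRate_induce G hB j ht]
  exact M.rate_predictable j _ _ _ t ht _ _ fun ⟨v, hv⟩ s hs => hxy v hv s hs

-- Passing to an induced subgraph can only shrink `cl(v)`, and the constants are monotone; one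
-- thinning level, taken from `G`, thus serves both solutions.
variable {M} in
theorem BoundedRates.jumpRate_induce_le {C : ℕ → ℝ≥0 → ℝ≥0} (hC : BoundedRates M C) (W : Set V)
    (v : W) (j : 𝒥) (x : W → Path 𝒳) {t T : ℝ≥0} (ht : t ≤ T) :
    M.jumpRate (G.induce W) v j t x ≤ C (closedNbhd G.graph (v : V)).ncard T := by
  refine (hC.bound _ (G.induce W) v j x T t ht).trans (hC.mono _ _ _ _ ?_ le_rfl)
  rw [← ncard_image_of_injective _ Subtype.val_injective]
  exact ncard_le_ncard ((image_closedNbhd_induce G.graph W v).trans_subset inter_subset_left)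
    (G.closedNbhd_finite v)

variable {M} in
/-- The solutions on two induced subgraphs agree at a vertex whenever the vertices that influence
it lie in the smaller subgraph. -/
theorem IsSolution.ae_eq_of_causalSet_subset {C : ℕ → ℝ≥0 → ℝ≥0} (hC : BoundedRates M C)
    {Ω : Type w} [MeasurableSpace Ω] {P : Measure Ω} {𝔽 𝔾 : ℝ≥0 → MeasurableSpace Ω}
    {N : V → Ω → Measure (Points 𝒥)} (hN : IsPoissonNoise P M.ς N) {T : ℝ≥0} {B W : Set V}
    (hBW : B ⊆ W) (ξ : V → 𝒳) {X : W → Ω → Path 𝒳} {Y : B → Ω → Path 𝒳}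
    (hX : IsSolution M (G.induce W) (fun v => ξ v) P 𝔽 (fun v => N v) X)
    (hY : IsSolution M (G.induce B) (fun v => ξ v) P 𝔾 (fun v => N v) Y) {U : Finset V}
    (hU : (U : Set V) ⊆ B) (hfin : ∀ᵐ ω ∂P, (causalSet G.graph C N T U ω).Finite) :
    ∀ᵐ ω ∂P, causalSet G.graph C N T U ω ⊆ B → ∀ (v : V) (hv : v ∈ U) (t : ℝ≥0), t ≤ T →
      X ⟨v, hBW (hU hv)⟩ ω t = Y ⟨v, hU hv⟩ ω t := by
  have := G.countable
  have := M.ς_finite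
  filter_upwards [hfin, hX.sde, hY.sde, hN.ae_regular G.graph C T] with ω hfin hX hY hreg hsub v hv
    t ht
  set E := eventTimes G.graph C N T ω
  have hinfl : influenceSet G.graph E v t ⊆ causalSet G.graph C N T U ω := by
    rw [causalSet_eq]
    exact (influenceSet_mono ht).trans (subset_biUnion_of_mem (u := fun u =>
      influenceSet G.graph E u T) (Finset.mem_coe.mpr hv))
  have key := not_disagree_of_influenceSet_subset hfin (fun u => (hreg u).1)
    (fun u s => ∃ hu : u ∈ B, X ⟨u, hBW hu⟩ ω s ≠ Y ⟨u, hu⟩ ω s) ?_ v t ht hinfl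
  · by_contra hne
    exact key ⟨hU hv, hne⟩
  rintro u s hs huA ⟨hu, hne⟩
  -- If no event of `u` up to `s` is preceded by a disagreement in `cl(u)`, the two integrands agree
  -- at almost every point of the noise, and so do the two solutions at `u`.
  by_contra hcon
  push Not at hcon
  refine hne (Subtype.ext ?_)
  have hXs := (hX ⟨u, hBW hu⟩ s).2
  have hYs := (hY ⟨u, hu⟩ s).2
  suffices h : (((X ⟨u, hBW hu⟩ ω s : 𝒳) : ℤ) : ℝ) = ((Y ⟨u, hu⟩ ω s : 𝒳) : ℤ) by
    exact_mod_cast h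
  rw [hXs, hYs]
  congr 1
  refine setIntegral_congr_ae (measurableSet_Ioc.prod .univ) ?_
  filter_upwards [(hreg u).2] with z hz hzs
  have hzT : z.1 ∈ Ioc 0 T := ⟨hzs.1.1, hzs.1.2.trans hs⟩
  by_cases hzc : z.2.1 ≤ C (closedNbhd G.graph u).ncard T
  · have hzE := hz hzT hzc
    -- The event at `u` makes each neighbor influence `u` through a one-step chain, so `cl(u)` lies
    -- in the causal set and hence in `B`; both subgraphs then see the full star of `u`.
    have hcl : closedNbhd G.graph u ⊆ B := by
      rintro y (rfl | hy)
      · exact hu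
      · exact hsub (huA (influenceSet_subset_of_adj hy.symm hzE hzT.1 hzs.1.2
          (mem_influenceSet_self _ _ _ 0)))
    rw [M.jumpRate_induce_congr G hcl (hcl.trans hBW) z.2.2 hzT.1 (fun u => X u ω)
      (fun u => Y u ω)]
    intro y hy r hr
    exact hcon z.1 hzE hzs.1.2 y r (hy.imp id fun h => h.symm) hr (hcl hy)
  -- Points above the thinning level are rejected by both solutions.
  · rw [if_neg, if_neg]
    · exact fun h => hzc (h.trans (hC.jumpRate_induce_le G B ⟨u, hu⟩ _ _ hzT.2))
    · exact fun h => hzc (h.trans (hC.jumpRate_induce_le G W ⟨u, hBW hu⟩ _ _ hzT.2))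

variable {M} in
/-- Causal sets are localizing maps. -/
theorem isLocalizingMap_causalSet {C : ℕ → ℝ≥0 → ℝ≥0} (hC : BoundedRates M C) (o : V)
    (hG : FinitelyDissociable.{u, w} M.ς C G.graph) {Ω : Type w} [mΩ : MeasurableSpace Ω]
    {P : Measure Ω} {𝔽 : Filtration ℝ≥0 mΩ} {N : V → Ω → Measure (Points 𝒥)}
    (hN : IsNoisePair P 𝔽 M.ς N) (T : ℝ≥0) :
    IsLocalizingMap M G o P 𝔽 N T (causalSet G.graph C N T) := by
  have := G.countable
  have := M.ς_finite
  have := hN.prob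
  have hfin := hG.ae_finite_causalSet G.locallyFinite hN.noise T
  refine ⟨measurableSet_causalSet_subset hN.noise G.graph C T, fun U => ?_, fun U ω u hu => ?_,
    fun ℓ ξ U W hU hW X hX Y hY => ?_⟩
  · filter_upwards [hfin] with ω h using h U
  · rw [causalSet_eq]
    exact mem_biUnion hu (mem_influenceSet_self _ _ _ _)
  · refine IsSolution.ae_eq_of_causalSet_subset G hC hN.noise hW ξ hX hY hU ?_
    filter_upwards [hfin] with ω h using h U

end

/-! ### Consistency -/

/-- The degree enters through the thinning level: without equal degrees the same noise would be
thinned differently. -/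
theorem eventTimes_eq_of_restrict_eq {𝒥 : Set ℤ} {V V' : Type u} {G : SimpleGraph V}
    {G' : SimpleGraph V'} {C : ℕ → ℝ≥0 → ℝ≥0} {Ω : Type w} {N : V → Ω → Measure (Points 𝒥)}
    {N' : V' → Ω → Measure (Points 𝒥)} {T : ℝ≥0} {ω : Ω} {v : V} {v' : V'}
    (hdeg : (closedNbhd G' v').ncard = (closedNbhd G v).ncard)
    (hN : (N' v' ω).restrict (Iic T ×ˢ univ) = (N v ω).restrict (Iic T ×ˢ univ)) :
    eventTimes G' C N' T ω v' = eventTimes G C N T ω v := by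
  ext t
  refine and_congr_right fun ht => ?_
  have hsub : ∀ c : ℝ≥0, ({t} ×ˢ Ioc 0 c ×ˢ univ : Set (Points 𝒥)) ⊆ Iic T ×ˢ univ := fun c =>
    prod_mono (singleton_subset_iff.mpr ht.2) (subset_univ _)
  rw [thinned, thinned, hdeg, ← Measure.restrict_eq_self _ (hsub _), hN,
    Measure.restrict_eq_self _ (hsub _)]

/-- A pathwise statement. Chains in `G'` are carried to `G` by `Influences.mem_of_subset`, which
also yields the inclusion in `B'`; chains in `G` come back by `Influences.map_iso`. -/
theorem causalSet_eq_image_of_iso {𝒥 : Set ℤ} {V V' : Type u} {G : SimpleGraph V}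
    {G' : SimpleGraph V'} {C : ℕ → ℝ≥0 → ℝ≥0} {Ω : Type w} {N : V → Ω → Measure (Points 𝒥)}
    {N' : V' → Ω → Measure (Points 𝒥)} {T : ℝ≥0} {ω : Ω} {B : Set V} {B' : Set V'}
    (hfin : ∀ x, (closedNbhd G' x).Finite) (φ : G'.induce B' ≃g G.induce B)
    (hdeg : ∀ x : B', (closedNbhd G' (x : V')).ncard = (closedNbhd G (φ x : V)).ncard)
    {U : Finset V} {U' : Finset V'} (hU : (U : Set V) ⊆ B) (hU' : (U' : Set V') ⊆ B')
    (hUU' : ∀ x : B', (x : V') ∈ U' ↔ (φ x : V) ∈ U) (hsub : causalSet G C N T U ω ⊆ B)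
    (hN : ∀ x : B', (N' x ω).restrict (Iic T ×ˢ univ) = (N (φ x) ω).restrict (Iic T ×ˢ univ)) :
    causalSet G' C N' T U' ω ⊆ B' ∧
      causalSet G C N T U ω = (fun x : B' => (φ x : V)) '' {x | (x : V') ∈ causalSet G' C N' T U' ω} := by
  have hE : ∀ x : B', eventTimes G' C N' T ω x = eventTimes G C N T ω (φ x) := fun x =>
    eventTimes_eq_of_restrict_eq (hdeg x) (hN x)
  rw [causalSet_eq] at hsub
  simp only [iUnion_subset_iff] at hsub
  have hmem : ∀ {v u t}, u ∈ U' → t ≤ T → Influences G' (eventTimes G' C N' T ω) v u t →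
      ∃ (hv : v ∈ B') (u' : V), u' ∈ U ∧ Influences G (eventTimes G C N T ω) (φ ⟨v, hv⟩ : V) u' t := by
    intro v u t hu ht h
    have hφu : (φ ⟨u, hU' hu⟩ : V) ∈ U := (hUU' ⟨u, hU' hu⟩).mp hu
    obtain ⟨hv, h'⟩ := h.mem_of_subset φ hfin hdeg hE (eventTimes_pos G C T ω) (hU' hu)
      ((influenceSet_mono ht).trans (hsub _ hφu))
    exact ⟨hv, _, hφu, h'⟩
  simp only [causalSet_eq]
  constructor
  · intro v hv
    simp only [mem_iUnion] at hv
    obtain ⟨u, hu, t, ht, h⟩ := hv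
    exact (hmem hu ht h).1
  · ext v
    simp only [mem_iUnion, mem_image, mem_ofPred_eq]
    constructor
    · rintro ⟨u, hu, t, ht, h⟩
      obtain ⟨x, hx⟩ := φ.surjective ⟨u, hU hu⟩
      have hx' : (φ x : V) = u := congrArg Subtype.val hx
      obtain ⟨y, hy, h'⟩ := h.map_iso φ hE ((influenceSet_mono ht).trans (hsub u hu)) x hx'
      exact ⟨y, ⟨x, (hUU' x).mpr (hx' ▸ hu), t, ht, h'⟩, hy⟩
    · rintro ⟨y, ⟨u, hu, t, ht, h⟩, rfl⟩
      obtain ⟨_, u', hu', h'⟩ := hmem hu ht h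
      exact ⟨u', hu', t, ht, h'⟩

theorem isConsistentSequence_causalSet {𝒳 𝒥 : Set ℤ} {Ke Kv : Type*} [MeasurableSpace Ke]
    [MeasurableSpace Kv] {M : Model.{u} 𝒳 𝒥 Ke Kv} {C : ℕ → ℝ≥0 → ℝ≥0} (hC : BoundedRates M C)
    {V : ℕ → Type u} (G : (n : ℕ) → MarkedGraph (V n) Ke Kv) (o : (n : ℕ) → V n)
    (hG : ∀ n, FinitelyDissociable.{u, w} M.ς C (G n).graph)
    {Ω : Type w} [mΩ : MeasurableSpace Ω] {P : Measure Ω} {𝔽 : ℕ → Filtration ℝ≥0 mΩ}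
    {N : (n : ℕ) → V n → Ω → Measure (Points 𝒥)} (hN : ∀ n, IsNoisePair P (𝔽 n) M.ς (N n))
    (T : ℝ≥0) :
    IsConsistentSequence M G o P 𝔽 N T (fun n => causalSet (G n).graph C (N n) T) where
  localizing n := isLocalizingMap_causalSet (G n) hC (o n) (hG n) (hN n) T
  consistent _ n' _ φ _ hdeg _ _ hU hU' hUU' := ae_of_all _ fun _ hsub hNN =>
    causalSet_eq_image_of_iso (G n').closedNbhd_finite φ hdeg hU hU' hUU' hsub hNN

end IPS

theorem mainTheorem10 {𝒳 𝒥 : Set ℤ} {Ke Kv : Type*}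
    [TopologicalSpace Ke] [PolishSpace Ke] [MeasurableSpace Ke] [BorelSpace Ke]
    [TopologicalSpace Kv] [PolishSpace Kv] [MeasurableSpace Kv] [BorelSpace Kv]
    (M : IPS.Model.{u} 𝒳 𝒥 Ke Kv) (C : ℕ → ℝ≥0 → ℝ≥0) (hC : IPS.BoundedRates M C) :
    (∀ (V : Type u) (G : IPS.MarkedGraph V Ke Kv) (o : V),
      IPS.FinitelyDissociable.{u, w} M.ς C G.graph →
      IPS.SpatiallyLocalizes.{u, w} M G o ∧
      ∀ (Ω : Type w) (mΩ : MeasurableSpace Ω) (P : Measure Ω) (𝔽 : Filtration ℝ≥0 mΩ)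
        (N : V → Ω → Measure (IPS.Points 𝒥)), IPS.IsNoisePair P 𝔽 M.ς N →
        ∀ T : ℝ≥0, IPS.IsLocalizingMap M G o P 𝔽 N T (IPS.causalSet G.graph C N T)) ∧
    (∀ (V : ℕ → Type u) (G : (n : ℕ) → IPS.MarkedGraph (V n) Ke Kv) (o : (n : ℕ) → V n),
      (∀ n, IPS.FinitelyDissociable.{u, w} M.ς C (G n).graph) →
      IPS.ConsistentlySpatiallyLocalizes.{u, w} M G o ∧
      ∀ (Ω : Type w) (mΩ : MeasurableSpace Ω) (P : Measure Ω) (𝔽 : ℕ → Filtration ℝ≥0 mΩ)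
        (N : (n : ℕ) → V n → Ω → Measure (IPS.Points 𝒥)),
        (∀ n, IPS.IsNoisePair P (𝔽 n) M.ς (N n)) →
        ∀ T : ℝ≥0, IPS.IsConsistentSequence M G o P 𝔽 N T
          (fun n => IPS.causalSet (G n).graph C (N n) T)) := by
  refine ⟨fun V G o hG => ?_, fun V G o hG => ?_⟩
  · have h : ∀ (Ω : Type w) (mΩ : MeasurableSpace Ω) (P : Measure Ω) (𝔽 : Filtration ℝ≥0 mΩ)
        (N : V → Ω → Measure (IPS.Points 𝒥)), IPS.IsNoisePair P 𝔽 M.ς N →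
        ∀ T : ℝ≥0, IPS.IsLocalizingMap M G o P 𝔽 N T (IPS.causalSet G.graph C N T) :=
      fun _ _ _ _ _ hN T => IPS.isLocalizingMap_causalSet G hC o hG hN T
    exact ⟨fun Ω mΩ P 𝔽 N hN T => ⟨_, h Ω mΩ P 𝔽 N hN T⟩, h⟩
  · have h : ∀ (Ω : Type w) (mΩ : MeasurableSpace Ω) (P : Measure Ω) (𝔽 : ℕ → Filtration ℝ≥0 mΩ)
        (N : (n : ℕ) → V n → Ω → Measure (IPS.Points 𝒥)),
        (∀ n, IPS.IsNoisePair P (𝔽 n) M.ς (N n)) →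
        ∀ T : ℝ≥0, IPS.IsConsistentSequence M G o P 𝔽 N T
          (fun n => IPS.causalSet (G n).graph C (N n) T) :=
      fun _ _ _ _ _ hN T => IPS.isConsistentSequence_causalSet hC G o hG hN T
    exact ⟨fun Ω mΩ P 𝔽 N hN T => ⟨_, h Ω mΩ P 𝔽 N hN T⟩, h⟩
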